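/- **Model.** In the CONGESTED CLIQUE model with bandwidth $B$, the nodes are $0,\dots,n-1$; the input is a graph $G$ on these $n$ nodes, and each node initially knows $n$, its own identifier and its neighbours in $G$. Computation proceeds in synchronous rounds; in every round each node may send to every node a (possibly different) message of $B$ bits, or nothing. Local computation is unrestricted, and every node has private, independent random choices (in every round a uniformly random element of a finite set fixed by the algorithm). Each node eventually halts with an output, a family of sets of nodes, and sends nothing afterwards. An algorithm *lists $K_p$* on $G$ *within $t$ rounds* if after at most $t$ rounds all nodes have halted and the union of their outputs is exactly the set of all $p$-cliques of $G$. Messages of $O(\log n)$ bits means $B=b\lceil\log_2 n\rceil$ for a constant $b$. Write $e(G)$ for the number of edges of $G$; all logarithms are base $2$. **Theorem.** For every $p\ge 3$, $K_p$ listing in the CONGESTED CLIQUE model takes $\tilde\Theta(1+m/n^{1+2/p})$ rounds with high probability, where $m$ is the number of edges of the input graph. Precisely: (1) *Upper bound.* There are constants $b,k\in\mathbb N$ such that for every $a\in\mathbb N$ there is a constant $C>0$ (independent of $p$) with the following property. For all $p\ge 3$ and $n\ge 2$ there is an algorithm with bandwidth $b\lceil\log n\rceil$ that, on every $n$-node graph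 $G$, with probability at least $1-n^{-a}$ lists $K_p$ on $G$ within at most $$C\,(\log n)^k\left(1+\frac{e(G)}{n^{1+2/p}}\right)$$ rounds. (The algorithm is not given $e(G)$.) (2) *Lower bound.* There is a constant $k\in\mathbb N$ such that for all $b\in\mathbb N$ and $\lambda\in\mathbb R$ there is a constant $c>0$ with the following property. Let $p\ge 3$, $n$ and $m$ be such that $p\le\lambda\log n$ and $\binom p2\le m\le\binom n2$ (so for a fixed $p$, taking $\lambda=p$, every $n\ge 2$ is allowed). Let an algorithm with bandwidth $b\lceil\log n\rceil$ and a real $\varepsilon$ be given such that, on every $n$-node graph with at most $m$ edges, the algorithm lists $K_p$ within finitely many rounds with probability at least $1-\varepsilon$. Then there is an $n$-node graph $G$ with $m/4\le e(G)\le m$ on which, with probability at least $1-4\varepsilon-1/n$, the nodes have not all halted before $$\frac{c}{(\log n)^k}\left(1+\frac{m}{n^{1+2/p}}\right)$$ rounds have passed. -/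

import Mathlib

open MeasureTheory

noncomputable section

namespace CongestedClique

/-- A randomized algorithm in the `CONGESTED CLIQUE` model on the nodes `Fin n`, with bandwidth `B`.
Nodes know `n` and have the identifiers `0, …, n - 1`. The local input of a node is its set of
neighbours in the input graph. Local computation is unrestricted. In each synchronous round each
node may send to each node either nothing or a string of `B` bits, a different one to each
recipient. Before the first round, and again at the end of each round, every node privately draws
a fresh uniformly random element of a finite set with `faces + 1` elements. A node halts as soon
as `output` is defined in its current state; the value is the set of vertex sets that it lists. -/
structure Algorithm (n B : ℕ) where
  /-- local states of a node -/
  State : Type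
  /-- the random values are drawn from a set with `faces + 1` elements -/
  faces : ℕ
  /-- initial state, from the identifier, the neighbours in the input graph and a random value -/
  init : Fin n → Set (Fin n) → Fin (faces + 1) → State
  /-- the message that a node in the given state sends to the given node -/
  send : State → Fin n → Option (BitVec B)
  /-- next state, from the current state, the messages received (indexed by their senders)
  and a random value -/
  next : State → (Fin n → Option (BitVec B)) → Fin (faces + 1) → State
  /-- `none` while the node is running, and the node's final output once it has halted -/
  output : State → Option (Set (Finset (Fin n)))

namespace Algorithm

variable {n B : ℕ}

/-- All random choices of an execution: `ω (v, t)` is the `t`-th random value drawn by `v`. -/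
abbrev Coins (A : Algorithm n B) : Type := Fin n × ℕ → Fin (A.faces + 1)

/-- The random values are independent and uniform. -/
def law (A : Algorithm n B) : Measure A.Coins :=
  Measure.infinitePi fun _ => (PMF.uniformOfFintype (Fin (A.faces + 1))).toMeasure

instance (A : Algorithm n B) : IsProbabilityMeasure A.law := by
  unfold law; infer_instance

/-- The state of each node after `t` rounds on the input graph `G`. A node that has halted keeps
its state and sends nothing. -/
def run (A : Algorithm n B) (G : SimpleGraph (Fin n)) (ω : A.Coins) : ℕ → Fin n → A.State
  | 0, v => A.init v (G.neighborSet v) (ω (v, 0))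
  | t + 1, v =>
    if (A.output (A.run G ω t v)).isSome then A.run G ω t v
    else A.next (A.run G ω t v)
      (fun u => if (A.output (A.run G ω t u)).isSome then none else A.send (A.run G ω t u) v)
      (ω (v, t + 1))

/-- Every node has halted after at most `t` rounds. -/
def HaltsBy (A : Algorithm n B) (G : SimpleGraph (Fin n)) (ω : A.Coins) (t : ℕ) : Prop :=
  ∀ v, (A.output (A.run G ω t v)).isSome

/-- Every node has halted after at most `t` rounds, and the union of the outputs of the nodes is
exactly the set of all `p`-cliques of `G`. -/
def ListsBy (A : Algorithm n B) (p : ℕ) (G : SimpleGraph (Fin n)) (ω : A.Coins) (t : ℕ) : Prop :=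
  A.HaltsBy G ω t ∧
    {S | ∃ v, ∃ L, A.output (A.run G ω t v) = some L ∧ S ∈ L} = G.cliqueSet p

end Algorithm

/-- The number of edges of a graph. -/
def numEdges {n : ℕ} (G : SimpleGraph (Fin n)) : ℕ := G.edgeSet.ncard

/-- The quantity `1 + m / n ^ (1 + 2 / p)`. -/
def cost (p n m : ℕ) : ℝ := 1 + (m : ℝ) / (n : ℝ) ^ (1 + 2 / (p : ℝ))

end CongestedClique

end

/-! Upper bound. Colour the nodes at random with `q = ⌊n^(1/p)⌋` colours. As `q ^ p ≤ n`, the tuples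
of `p` colours can be distributed among the nodes, and a node that learns all edges between the
colours of its tuple finds every clique with these colours. To balance the sending, each node `u`
also draws a random shift `r u` and hands the directed edge `(u, w)` to the node `w + r u`. One
round does this and makes all colours and degrees known everywhere; then each holder `h` sends to
each `x` the edges that `x` wants, one per round. Between two given colours, `h` holds about `2m /
(n q²)` directed edges up to constant factors and an additive logarithm (`card_lt_totalLoad_le`),
and `x` wants at most `log n` colours (`exists_color_sets`). This gives the number of rounds. It
depends on `m` only through the sum of the degrees, which every node knows, so all nodes stop
together.

Lower bound. Start from a complete graph on `N` vertices with `N.choose 2` close to `m`, group its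
edges into blocks of size `s = 2p²` and delete one edge of each block. Whatever the deletions, at
least half of the `p`-cliques survive (`choose_le_two_mul_ncard_cliqueSet`), so some node lists at
least a `1/(2n)` fraction of `N.choose p` cliques. A graph with `e` edges has at most `(2e)^(p/2) /
p!` cliques (`factorial_mul_card_sq_le`), hence the listed cliques span at least `d = N² / (16
n^(2/p))` edges. A fixed list of this kind is correct only if no spanned edge is deleted, which
holds for a fraction at most `exp (-d/s)` of the deletions (`card_forall_isNClique_holeGraph_le`).
With its coins fixed, a node can produce at most `2^n (2^B + 1)^(n t)` lists in `t` rounds, since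
its state depends only on its neighbours and the received messages. By a union bound, success on
many deletions forces `d/s` to be at most of order `n t B` (`card_listsBy_holeGraph_lt`). Averaging
over the graphs fixes the coins of a randomized algorithm.

When the claimed bound is at most one round, it only has to be excluded that all nodes halt without
communicating. A node listing a clique at time `0` cannot see an edge of the clique away from
itself, and errs if that edge is deleted (`law_real_haltsBy_zero_le`). -/

noncomputable section

namespace CongestedClique

/-! ### Halting, measurability and the law of the initial coins -/

namespace Algorithm

variable {n B p : ℕ} (A : Algorithm n B)

lemma run_add_of_isSome {G : SimpleGraph (Fin n)} {ω : A.Coins} {t : ℕ} {v : Fin n}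
    (h : (A.output (A.run G ω t v)).isSome) (k : ℕ) : A.run G ω (t + k) v = A.run G ω t v := by
  induction k with
  | zero => rfl
  | succ k ih =>
    rw [← add_assoc, run, if_pos]
    · exact ih
    · rw [ih]; exact h

lemma run_of_isSome_of_le {G : SimpleGraph (Fin n)} {ω : A.Coins} {s t : ℕ} {v : Fin n}
    (h : (A.output (A.run G ω s v)).isSome) (hst : s ≤ t) : A.run G ω t v = A.run G ω s v := by
  obtain ⟨k, rfl⟩ := Nat.exists_eq_add_of_le hst
  exact A.run_add_of_isSome h k

variable {A}

lemma HaltsBy.run_eq {G : SimpleGraph (Fin n)} {ω : A.Coins} {s t : ℕ}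
    (h : A.HaltsBy G ω s) (hst : s ≤ t) : A.run G ω t = A.run G ω s :=
  funext fun v => A.run_of_isSome_of_le (h v) hst

lemma HaltsBy.mono {G : SimpleGraph (Fin n)} {ω : A.Coins} {s t : ℕ}
    (h : A.HaltsBy G ω s) (hst : s ≤ t) : A.HaltsBy G ω t := by
  intro v
  rw [h.run_eq hst]
  exact h v

/-- Halted states are frozen, so correctness at any time transfers to any time at which all nodes
have halted. The lower bound uses this to turn early halting into early listing. -/
lemma ListsBy.of_haltsBy {G : SimpleGraph (Fin n)} {ω : A.Coins} {s t : ℕ}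
    (h : A.ListsBy p G ω t) (hs : A.HaltsBy G ω s) : A.ListsBy p G ω s := by
  refine ⟨hs, ?_⟩
  have : A.run G ω s = A.run G ω t := by
    rcases le_total s t with hst | hst
    · exact (hs.run_eq hst).symm
    · exact h.1.run_eq hst
  rw [this]
  exact h.2

variable (A)

lemma run_congr (G : SimpleGraph (Fin n)) {ω ω' : A.Coins} (t : ℕ)
    (h : ∀ v, ∀ s ≤ t, ω (v, s) = ω' (v, s)) : A.run G ω t = A.run G ω' t := by
  induction t with
  | zero => funext v; simp [run, h v 0 le_rfl]
  | succ t ih =>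
    have ih := ih fun v s hs => h v s (hs.trans (Nat.le_succ t))
    funext v
    simp only [run, ih, h v (t + 1) le_rfl]

/-- Only finitely many coins influence the first `t` rounds, so the event is the preimage of a
subset of a finite space. -/
lemma measurableSet_run (G : SimpleGraph (Fin n)) (t : ℕ) (Q : (Fin n → A.State) → Prop) :
    MeasurableSet {ω : A.Coins | Q (A.run G ω t)} := by
  let I : Finset (Fin n × ℕ) := Finset.univ ×ˢ Finset.range (t + 1)
  have hm : Measurable (I.restrict : A.Coins → (I → Fin (A.faces + 1))) :=
    Finset.measurable_restrict I
  have : {ω : A.Coins | Q (A.run G ω t)} =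
      (I.restrict : A.Coins → (I → Fin (A.faces + 1))) ⁻¹'
        (I.restrict '' {ω : A.Coins | Q (A.run G ω t)}) := by
    refine Set.Subset.antisymm (Set.subset_preimage_image _ _) ?_
    rintro ω ⟨ω', hω', heq⟩
    have : A.run G ω t = A.run G ω' t := by
      refine A.run_congr G t fun v s hs => ?_
      have hmem : (v, s) ∈ I := by simp [I]; omega
      exact (congrFun heq ⟨(v, s), hmem⟩).symm
    simpa [this] using hω'
  rw [this]
  exact hm (Set.toFinite _).measurableSet

lemma measurableSet_haltsBy (G : SimpleGraph (Fin n)) (t : ℕ) :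
    MeasurableSet {ω : A.Coins | A.HaltsBy G ω t} :=
  A.measurableSet_run G t fun r => ∀ v, (A.output (r v)).isSome

lemma measurableSet_listsBy (p : ℕ) (G : SimpleGraph (Fin n)) (t : ℕ) :
    MeasurableSet {ω : A.Coins | A.ListsBy p G ω t} :=
  A.measurableSet_run G t fun r => (∀ v, (A.output (r v)).isSome) ∧
    {S | ∃ v, ∃ L, A.output (r v) = some L ∧ S ∈ L} = G.cliqueSet p

lemma measurableSet_exists_listsBy (p : ℕ) (G : SimpleGraph (Fin n)) :
    MeasurableSet {ω : A.Coins | ∃ t, A.ListsBy p G ω t} := by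
  rw [Set.ofPred_exists]
  exact MeasurableSet.iUnion fun t => A.measurableSet_listsBy p G t

/-- Reduces probabilities to counting. The listing algorithm uses no coins beyond the initial ones.
-/
lemma law_real_init_le (S : Finset (Fin n → Fin (A.faces + 1))) :
    A.law.real {ω : A.Coins | (fun v => ω (v, 0)) ∈ S} ≤ S.card / ((A.faces : ℝ) + 1) ^ n := by
  have hpt : ∀ g : Fin n → Fin (A.faces + 1),
      A.law.real {ω : A.Coins | (fun v => ω (v, 0)) = g} = 1 / ((A.faces : ℝ) + 1) ^ n := by
    intro g
    have hset : {ω : A.Coins | (fun v => ω (v, 0)) = g} =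
        Set.pi ((Finset.univ : Finset (Fin n)).map ⟨fun v => (v, 0), fun a b h => by simpa using h⟩ :
          Finset (Fin n × ℕ)) (fun i => {g i.1}) := by
      ext ω
      simp only [Finset.coe_map, Finset.coe_univ, Set.image_univ, Set.mem_pi, Set.mem_range,
        forall_exists_index, forall_apply_eq_imp_iff, Set.mem_singleton_iff, funext_iff]
      rfl
    rw [hset, law, Measure.real, Measure.infinitePi_pi _ (by simp)]
    simp [ENNReal.toReal_inv, PMF.uniformOfFintype_apply, ENNReal.toReal_add]
  have hset : {ω : A.Coins | (fun v => ω (v, 0)) ∈ S} =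
      ⋃ g ∈ S, {ω : A.Coins | (fun v => ω (v, 0)) = g} := by
    ext ω; simp
  rw [hset]
  refine (measureReal_biUnion_finset_le S _).trans ?_
  simp [hpt, div_eq_mul_inv]

end Algorithm

/-! ### The listing algorithm and its correctness -/

/-- What a node `u` tells a node `h` in the first round: its colour, its degree, and the neighbour
(if any) for which `h` is responsible. -/
abbrev Greeting (n q : ℕ) : Type := Fin q × Fin (n + 1) × Option (Fin n)

/-- Local states of a node in the listing algorithm. -/
structure ListState (n q : ℕ) where
  /-- number of elapsed rounds -/
  time : ℕ
  /-- neighbours in the input graph -/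
  nbrs : Set (Fin n)
  /-- own colour and own shift -/
  coin : Fin q × Fin n
  /-- the greetings received in the first round -/
  first : Fin n → Greeting n q
  /-- the directed edges received after the first round -/
  got : Set (Fin n × Fin n)

/-- Parameters of the listing algorithm. -/
structure Scheme (n q B : ℕ) where
  /-- the coins have `faces + 1` faces -/
  faces : ℕ
  /-- a coin encodes a colour and a shift -/
  coin : Fin (faces + 1) ≃ Fin q × Fin n
  /-- the colours such that a node collects the edges between them -/
  want : Fin n → Finset (Fin q)
  /-- number of rounds of the second phase, as a function of the sum of the degrees -/
  rounds : ℕ → ℕ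
  /-- encoding of greetings -/
  encGreeting : Greeting n q → BitVec B
  /-- decoding of greetings -/
  decGreeting : BitVec B → Greeting n q
  decGreeting_encGreeting : ∀ x, decGreeting (encGreeting x) = x
  /-- encoding of directed edges -/
  encEdge : Fin n × Fin n → BitVec B
  /-- decoding of directed edges -/
  decEdge : BitVec B → Fin n × Fin n
  decEdge_encEdge : ∀ x, decEdge (encEdge x) = x

/-- The greeting of a node with neighbourhood `N` and coin `c` to the node `h`. -/
def greeting {n q : ℕ} (N : Set (Fin n)) (c : Fin q × Fin n) (h : Fin n) : Greeting n q :=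
  open Classical in
  (c.1, ⟨N.ncard, Nat.lt_succ_of_le ((Set.ncard_le_card N).trans_eq (Nat.card_fin n))⟩,
    if h - c.2 ∈ N then some (h - c.2) else none)

/-- The directed edges that are held by a node with the greetings `F` and whose end points have
colours in `W`. -/
def queueSet {n q : ℕ} (W : Finset (Fin q)) (F : Fin n → Greeting n q) : Finset (Fin n × Fin n) :=
  Finset.univ.filter fun e => (F e.1).2.2 = some e.2 ∧ (F e.1).1 ∈ W ∧ (F e.2).1 ∈ W

/-- `queueSet` as a list. -/
def queue {n q : ℕ} (W : Finset (Fin q)) (F : Fin n → Greeting n q) : List (Fin n × Fin n) :=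
  (queueSet W F).toList

namespace Scheme

variable {n q B : ℕ} (P : Scheme n q B)

/-- The listing algorithm with the given parameters. -/
def alg (p : ℕ) : Algorithm n B where
  State := ListState n q
  faces := P.faces
  -- The initial greetings are placeholders, overwritten in the first round.
  init _ N c := ⟨0, N, P.coin c, fun _ => ((P.coin c).1, 0, none), ∅⟩
  send s x :=
    if s.time = 0 then some (P.encGreeting (greeting s.nbrs s.coin x))
    else ((queue (P.want x) s.first)[s.time - 1]?).map P.encEdge
  next s msg _ :=
    if s.time = 0 then
      -- The default `0` is never used: in the first round every node writes to every node.
      ⟨1, s.nbrs, s.coin, fun u => P.decGreeting ((msg u).getD 0), s.got⟩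
    else
      ⟨s.time + 1, s.nbrs, s.coin, s.first, s.got ∪ {e | ∃ h m, msg h = some m ∧ P.decEdge m = e}⟩
  output s :=
    if s.time = 0 ∨ s.time < 1 + P.rounds (∑ u, ((s.first u).2.1 : ℕ)) then none
    else some {S | S.card = p ∧ ∀ a ∈ S, ∀ b ∈ S, a ≠ b → (a, b) ∈ s.got}

/-- The greetings that the node `h` receives. -/
def table (G : SimpleGraph (Fin n)) (ω : Fin n → Fin q × Fin n) (h : Fin n) :
    Fin n → Greeting n q :=
  fun u => greeting (G.neighborSet u) (ω u) h

lemma sum_ncard_neighborSet (G : SimpleGraph (Fin n)) :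
    ∑ u, (G.neighborSet u).ncard = 2 * numEdges G := by
  classical
  rw [numEdges, ← SimpleGraph.coe_edgeFinset, Set.ncard_coe_finset,
    ← G.sum_degrees_eq_twice_card_edges]
  refine Finset.sum_congr rfl fun u _ => ?_
  rw [← SimpleGraph.card_neighborFinset_eq_degree, ← Set.ncard_coe_finset,
    SimpleGraph.coe_neighborFinset]

lemma mem_queueSet_table (G : SimpleGraph (Fin n)) (ω : Fin n → Fin q × Fin n)
    (W : Finset (Fin q)) (h : Fin n) (e : Fin n × Fin n) : e ∈ queueSet W (table G ω h) ↔
      G.Adj e.1 e.2 ∧ h - (ω e.1).2 = e.2 ∧ (ω e.1).1 ∈ W ∧ (ω e.2).1 ∈ W := by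
  rw [queueSet, Finset.mem_filter]
  simp only [table, greeting, Finset.mem_univ, true_and, Option.ite_none_right_eq_some,
    Option.some.injEq, SimpleGraph.mem_neighborSet, and_assoc]
  constructor
  · rintro ⟨h1, h2, h3⟩
    exact ⟨h2 ▸ h1, h2, h3⟩
  · rintro ⟨h1, h2, h3⟩
    exact ⟨h2.symm ▸ h1, h2, h3⟩

variable (p : ℕ) (G : SimpleGraph (Fin n)) (ω : (P.alg p).Coins)

/-- The colours and shifts drawn initially. -/
def coins (ω : (P.alg p).Coins) : Fin n → Fin q × Fin n := fun v => P.coin (ω (v, 0))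

lemma run_zero (v : Fin n) :
    (P.alg p).run G ω 0 v = (⟨0, G.neighborSet v, P.coins p ω v,
      fun _ => ((P.coins p ω v).1, 0, none), ∅⟩ : ListState n q) := rfl

/-- The invariant of the second phase. The greetings give every node the same degree sum `2 *
numEdges G`, so nobody halts early and no message is suppressed. -/
lemma run_succ {t : ℕ} (ht : t ≤ P.rounds (2 * numEdges G)) (v : Fin n) :
    (P.alg p).run G ω (t + 1) v = (⟨t + 1, G.neighborSet v, P.coins p ω v,
      table G (P.coins p ω) v,
      {e | ∃ h, ∃ k < t, (queue (P.want v) (table G (P.coins p ω) h))[k]? = some e}⟩ :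
        ListState n q) := by
  induction t generalizing v with
  | zero =>
    have hout : ∀ u, (P.alg p).output ((P.alg p).run G ω 0 u) = none := by
      intro u
      rw [run_zero]
      simp [alg]
    rw [Algorithm.run]
    simp only [hout, Option.isSome_none, Bool.false_eq_true, if_false]
    simp only [run_zero]
    simp [alg, decGreeting_encGreeting]
    rfl
  | succ t ih =>
    have ih := fun u => ih (by omega) u
    have hout : ∀ u, (P.alg p).output ((P.alg p).run G ω (t + 1) u) = none := by
      intro u
      rw [ih]
      have : ∑ w, ((table G (P.coins p ω) u w).2.1 : ℕ) = 2 * numEdges G := by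
        rw [← sum_ncard_neighborSet]; rfl
      simp only [alg, this]
      rw [if_pos]
      right; omega
    rw [Algorithm.run]
    simp only [hout, Option.isSome_none, Bool.false_eq_true, if_false]
    simp only [ih]
    simp only [alg, Nat.add_eq_zero_iff, one_ne_zero, and_false, if_false, Nat.add_sub_cancel,
      ListState.mk.injEq, true_and]
    ext e
    simp only [Set.mem_union, Set.mem_ofPred_eq, Option.map_eq_some_iff]
    constructor
    · rintro (⟨h, k, hk, he⟩ | ⟨h, m, ⟨e', he', rfl⟩, rfl⟩)
      · exact ⟨h, k, by omega, he⟩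
      · exact ⟨h, t, by omega, by rw [he', P.decEdge_encEdge]⟩
    · rintro ⟨h, k, hk, he⟩
      rcases Nat.lt_succ_iff_lt_or_eq.mp hk with hk | rfl
      · exact Or.inl ⟨h, k, hk, he⟩
      · exact Or.inr ⟨h, _, ⟨e, he, rfl⟩, P.decEdge_encEdge e⟩

theorem listsBy [NeZero n]
    (hwant : ∀ S : Finset (Fin q), S.card ≤ p → ∃ x, S ⊆ P.want x)
    (hload : ∀ h x, (queueSet (P.want x) (table G (P.coins p ω) h)).card ≤
      P.rounds (2 * numEdges G)) :
    (P.alg p).ListsBy p G ω (P.rounds (2 * numEdges G) + 1) := by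
  have hrun := P.run_succ p G ω (le_refl (P.rounds (2 * numEdges G)))
  have hgot : ∀ v e, (∃ h, ∃ k < P.rounds (2 * numEdges G),
      (queue (P.want v) (table G (P.coins p ω) h))[k]? = some e) ↔
      ∃ h, e ∈ queueSet (P.want v) (table G (P.coins p ω) h) := by
    intro v e
    refine exists_congr fun h => ?_
    rw [← Finset.mem_toList, List.mem_iff_getElem?]
    constructor
    · rintro ⟨k, -, he⟩
      exact ⟨k, he⟩
    · rintro ⟨k, he⟩
      refine ⟨k, lt_of_lt_of_le ?_ (hload h v), he⟩
      rw [← Finset.length_toList]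
      exact (List.getElem?_eq_some_iff.mp he).1
  have hmem := fun W h e => mem_queueSet_table G (P.coins p ω) W h e
  have hout : ∀ v, (P.alg p).output ((P.alg p).run G ω (P.rounds (2 * numEdges G) + 1) v) =
      some {S | S.card = p ∧ ∀ a ∈ S, ∀ b ∈ S, a ≠ b →
        ∃ h, (a, b) ∈ queueSet (P.want v) (table G (P.coins p ω) h)} := by
    intro v
    rw [hrun]
    have : ∑ w, ((table G (P.coins p ω) v w).2.1 : ℕ) = 2 * numEdges G := by
      rw [← sum_ncard_neighborSet]; rfl
    simp only [alg, this]
    rw [if_neg (by omega)]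
    simp only [Set.mem_ofPred_eq, hgot]
  refine ⟨fun v => by rw [hout]; rfl, ?_⟩
  ext S
  simp only [hout, Set.mem_ofPred_eq, Option.some.injEq, exists_eq_left',
    SimpleGraph.mem_cliqueSet_iff, SimpleGraph.isNClique_iff]
  constructor
  · rintro ⟨v, hS, hadj⟩
    refine ⟨fun a ha b hb hab => ?_, hS⟩
    obtain ⟨h, hh⟩ := hadj a ha b hb hab
    exact ((hmem _ _ _).1 hh).1
  · rintro ⟨hclique, hS⟩
    classical
    obtain ⟨x, hx⟩ := hwant (S.image fun v => (P.coins p ω v).1)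
      (Finset.card_image_le.trans hS.le)
    -- The holder of the directed edge `(a, b)` is `b` moved by the shift of `a`.
    refine ⟨x, hS, fun a ha b hb hab => ⟨b + (P.coins p ω a).2, ?_⟩⟩
    rw [hmem]
    exact ⟨hclique ha hb hab, add_sub_cancel_right _ _, hx (Finset.mem_image_of_mem _ ha),
      hx (Finset.mem_image_of_mem _ hb)⟩

end Scheme

/-! ### Concentration of the load -/

open Finset in
/-- A Chernoff bound for sums of independent random variables with values in `[0, 1]`, in counting
form. -/
lemma card_lt_sum_le {V α : Type*} [Fintype V] [DecidableEq V] [Fintype α] [Nonempty α]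
    (f : V → α → ℝ) (hf0 : ∀ v a, 0 ≤ f v a) (hf1 : ∀ v a, f v a ≤ 1) (μ Λ : ℝ)
    (hμ : ∑ v, ∑ a, f v a ≤ μ * Fintype.card α) :
    (Nat.card {ω : V → α // 2 * μ + Λ < ∑ v, f v (ω v)} : ℝ) ≤
      Real.exp (-Λ) * (Fintype.card α : ℝ) ^ Fintype.card V := by
  classical
  have hα : (0 : ℝ) < Fintype.card α := by exact_mod_cast Fintype.card_pos
  rw [Nat.card_eq_fintype_card, Fintype.card_subtype]
  set S := univ.filter fun ω : V → α => 2 * μ + Λ < ∑ v, f v (ω v) with hS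
  -- Markov's inequality for the exponential moment, which factorises by independence.
  have h1 : (S.card : ℝ) * Real.exp (2 * μ + Λ) ≤ ∑ ω : V → α, Real.exp (∑ v, f v (ω v)) := by
    calc (S.card : ℝ) * Real.exp (2 * μ + Λ) = ∑ _ω ∈ S, Real.exp (2 * μ + Λ) := by simp
      _ ≤ ∑ ω ∈ S, Real.exp (∑ v, f v (ω v)) := by
        refine sum_le_sum fun ω hω => Real.exp_le_exp.2 ?_
        exact ((mem_filter.1 hω).2).le
      _ ≤ _ := sum_le_sum_of_subset_of_nonneg (subset_univ _) fun _ _ _ => (Real.exp_pos _).le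
  have h2 : ∑ ω : V → α, Real.exp (∑ v, f v (ω v)) = ∏ v, ∑ a, Real.exp (f v a) := by
    rw [prod_univ_sum, Fintype.piFinset_univ]
    simp [Real.exp_sum]
  have h3 : ∏ v, ∑ a, Real.exp (f v a) ≤
      ∏ v, ((Fintype.card α : ℝ) * Real.exp (2 * (∑ a, f v a) / Fintype.card α)) := by
    refine prod_le_prod (fun v _ => sum_nonneg fun a _ => (Real.exp_pos _).le) fun v _ => ?_
    -- On `[0, 1]`, `exp x ≤ 1 + x + x² ≤ 1 + 2x`; this is the origin of the factor `2` before `μ`.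
    calc ∑ a, Real.exp (f v a) ≤ ∑ a, (1 + 2 * f v a) := by
          refine sum_le_sum fun a _ => ?_
          have := Real.abs_exp_sub_one_sub_id_le (x := f v a)
            (by rw [abs_of_nonneg (hf0 v a)]; exact hf1 v a)
          have h := (abs_le.1 this).2
          nlinarith [hf0 v a, hf1 v a]
      _ = (Fintype.card α : ℝ) * (2 * (∑ a, f v a) / Fintype.card α + 1) := by
          rw [sum_add_distrib, ← mul_sum]
          simp
          field_simp
          ring
      _ ≤ _ := by
          gcongr
          exact Real.add_one_le_exp _
  have h4 : ∏ v, ((Fintype.card α : ℝ) * Real.exp (2 * (∑ a, f v a) / Fintype.card α)) ≤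
      (Fintype.card α : ℝ) ^ Fintype.card V * Real.exp (2 * μ) := by
    rw [prod_mul_distrib, ← Real.exp_sum, prod_const, card_univ]
    gcongr
    rw [← sum_div, ← mul_sum, div_le_iff₀ hα]
    linarith
  have h5 := h1.trans (h2.trans_le (h3.trans h4))
  have h6 : Real.exp (2 * μ + Λ) = Real.exp (2 * μ) * Real.exp Λ := Real.exp_add _ _
  rw [h6] at h5
  rw [Real.exp_neg, inv_mul_eq_div, le_div_iff₀ (Real.exp_pos _)]
  have := Real.exp_pos (2 * μ)
  refine le_of_mul_le_mul_right ?_ this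
  nlinarith

/-- Conditioning on the first components: a bound valid for each choice of them holds overall. It
allows a Chernoff bound over the shifts with the colours fixed. -/
lemma card_subtype_fst_snd_le {V α β : Type*} [Fintype V] [DecidableEq V] [Fintype α] [Fintype β]
    (Q : (V → α) → (V → β) → Prop) (ε : ℝ)
    (h : ∀ c, (Nat.card {r : V → β // Q c r} : ℝ) ≤ ε * (Fintype.card β : ℝ) ^ Fintype.card V) :
    (Nat.card {ω : V → α × β // Q (fun v => (ω v).1) (fun v => (ω v).2)} : ℝ) ≤
      ε * (Fintype.card (α × β) : ℝ) ^ Fintype.card V := by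
  classical
  let e : {ω : V → α × β // Q (fun v => (ω v).1) (fun v => (ω v).2)} ≃
      Σ c : V → α, {r : V → β // Q c r} :=
    { toFun := fun ω => ⟨fun v => (ω.1 v).1, fun v => (ω.1 v).2, ω.2⟩
      invFun := fun x => ⟨fun v => (x.1 v, x.2.1 v), x.2.2⟩
      left_inv := fun ω => rfl
      right_inv := fun x => rfl }
  rw [Nat.card_congr e, Nat.card_sigma]
  push_cast
  refine (Finset.sum_le_sum fun c _ => h c).trans_eq ?_
  simp only [Finset.sum_const, Finset.card_univ, Fintype.card_pi, Finset.prod_const, nsmul_eq_mul,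
    Fintype.card_prod]
  push_cast
  ring

section Load

variable {n q : ℕ} (adj : Fin n → Fin n → Prop)

open Classical in
/-- Number of neighbours of `v` with the given colour. -/
def colDeg (c : Fin n → Fin q) (v : Fin n) (j : Fin q) : ℕ :=
  (Finset.univ.filter fun w => adj v w ∧ c w = j).card

open Classical in
/-- Number of neighbours of `v`. -/
def outDeg (v : Fin n) : ℕ := (Finset.univ.filter fun w => adj v w).card

open Classical in
/-- Number of edges with end points of the given colours. -/
def colEdges (c : Fin n → Fin q) (i j : Fin q) : ℕ :=
  ∑ u with c u = i, colDeg adj c u j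

open Classical in
/-- Number of edges with end points of the given colours held by `h`. -/
def load (c : Fin n → Fin q) (r : Fin n → Fin n) (h : Fin n) (i j : Fin q) : ℕ :=
  (Finset.univ.filter fun u => c u = i ∧ adj u (h - r u) ∧ c (h - r u) = j).card

lemma card_lt_colDeg_le [NeZero n] [NeZero q] (v : Fin n) (j : Fin q) (Λ : ℝ) :
    (Nat.card {ω : Fin n → Fin q × Fin n //
        2 * ((outDeg adj v : ℝ) / q) + Λ < colDeg adj (fun v => (ω v).1) v j} : ℝ) ≤
      Real.exp (-Λ) * ((q : ℝ) * n) ^ n := by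
  classical
  have hq : (q : ℝ) ≠ 0 := by exact_mod_cast NeZero.ne q
  have := card_lt_sum_le (V := Fin n) (α := Fin q × Fin n)
    (fun w a => if adj v w ∧ a.1 = j then 1 else 0)
    (fun w a => by positivity) (fun w a => by split_ifs <;> norm_num) ((outDeg adj v : ℝ) / q) Λ
    (by
      have : ∀ w, ∑ a : Fin q × Fin n, (if adj v w ∧ a.1 = j then (1 : ℝ) else 0) =
          if adj v w then (n : ℝ) else 0 := by
        intro w
        rw [Fintype.sum_prod_type]
        by_cases hw : adj v w <;> simp [hw]
      simp only [this]
      rw [← Finset.sum_filter, Finset.sum_const, nsmul_eq_mul]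
      simp only [Fintype.card_prod, Fintype.card_fin, outDeg]
      push_cast
      apply le_of_eq
      field_simp)
  simpa [colDeg, Finset.sum_boole] using this

/-- The degrees are divided by `n` to bring the summands into `[0, 1]`. The number of edges between
two colour classes is quadratic in the colours, so it is not a sum of independent terms; it is
controlled through this degree sum together with `colDeg`. -/
lemma card_lt_sum_outDeg_le [NeZero n] [NeZero q] (i : Fin q) (Λ : ℝ) :
    (Nat.card {ω : Fin n → Fin q × Fin n //
        2 * ((∑ u, (outDeg adj u : ℝ)) / (n * q)) + Λ <
          ∑ v, if (ω v).1 = i then (outDeg adj v : ℝ) / n else 0} : ℝ) ≤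
      Real.exp (-Λ) * ((q : ℝ) * n) ^ n := by
  classical
  have hq : (q : ℝ) ≠ 0 := by exact_mod_cast NeZero.ne q
  have hn : (n : ℝ) ≠ 0 := by exact_mod_cast NeZero.ne n
  have := card_lt_sum_le (V := Fin n) (α := Fin q × Fin n)
    (fun v a => if a.1 = i then (outDeg adj v : ℝ) / n else 0)
    (fun w a => by positivity)
    (fun v a => by
      split_ifs
      · rw [div_le_one (by positivity)]
        have : outDeg adj v ≤ n := (Finset.card_le_univ _).trans_eq (Fintype.card_fin n)
        exact_mod_cast this
      · norm_num)
    ((∑ u, (outDeg adj u : ℝ)) / (n * q)) Λ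
    (by
      have : ∀ v, ∑ a : Fin q × Fin n, (if a.1 = i then (outDeg adj v : ℝ) / n else 0) =
          outDeg adj v := by
        intro w
        rw [Fintype.sum_prod_type_right]
        simp
        field_simp
      simp only [this]
      simp only [Fintype.card_prod, Fintype.card_fin]
      push_cast
      apply le_of_eq
      field_simp)
  simpa using this

lemma sum_ite_adj_sub [NeZero n] (c : Fin n → Fin q) (h u : Fin n) (i j : Fin q) :
    open Classical in
    ∑ s : Fin n, (if c u = i ∧ adj u (h - s) ∧ c (h - s) = j then (1 : ℝ) else 0) =
      if c u = i then (colDeg adj c u j : ℝ) else 0 := by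
  classical
  by_cases hu : c u = i
  · simp only [hu, true_and, if_true]
    rw [← Equiv.sum_comp (Equiv.subLeft h)]
    simp [colDeg, Finset.sum_boole]
  · simp [hu]

/-- For fixed colours, the edge that `u` hands to `h` depends only on the shift of `u`. Hence the
load is a sum of independent indicators with mean `colEdges / n`. -/
lemma card_lt_load_le [NeZero n] [NeZero q] (h : Fin n) (i j : Fin q) (Λ : ℝ) :
    (Nat.card {ω : Fin n → Fin q × Fin n //
        2 * ((colEdges adj (fun v => (ω v).1) i j : ℝ) / n) + Λ <
          load adj (fun v => (ω v).1) (fun v => (ω v).2) h i j} : ℝ) ≤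
      Real.exp (-Λ) * ((q : ℝ) * n) ^ n := by
  classical
  have hn : (n : ℝ) ≠ 0 := by exact_mod_cast NeZero.ne n
  have key := card_subtype_fst_snd_le (V := Fin n) (α := Fin q) (β := Fin n)
    (fun c r => 2 * ((colEdges adj c i j : ℝ) / n) + Λ < load adj c r h i j) (Real.exp (-Λ))
    (fun c => by
      have := card_lt_sum_le (V := Fin n) (α := Fin n)
        (fun u s => if c u = i ∧ adj u (h - s) ∧ c (h - s) = j then 1 else 0)
        (fun w a => by positivity) (fun w a => by split_ifs <;> norm_num)
        ((colEdges adj c i j : ℝ) / n) Λ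
        (by
          simp only [sum_ite_adj_sub]
          rw [← Finset.sum_filter, colEdges, Fintype.card_fin]
          push_cast
          apply le_of_eq
          field_simp)
      simpa [load, Finset.sum_boole] using this)
  simpa using key

open Classical in
/-- Number of edges held by `h` whose end points have colours in `W`. -/
def totalLoad (ω : Fin n → Fin q × Fin n) (W : Finset (Fin q)) (h : Fin n) : ℕ :=
  (Finset.univ.filter fun e : Fin n × Fin n => adj e.1 e.2 ∧ h - (ω e.1).2 = e.2 ∧
    (ω e.1).1 ∈ W ∧ (ω e.2).1 ∈ W).card

lemma totalLoad_le (ω : Fin n → Fin q × Fin n) (W : Finset (Fin q)) (h : Fin n) :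
    totalLoad adj ω W h ≤
      ∑ i ∈ W, ∑ j ∈ W, load adj (fun v => (ω v).1) (fun v => (ω v).2) h i j := by
  classical
  -- An edge held by `h` is determined by its first end point, since the second is `h` minus the
  -- shift of the first.
  have h1 : totalLoad adj ω W h ≤ (Finset.univ.filter fun u : Fin n =>
      adj u (h - (ω u).2) ∧ (ω u).1 ∈ W ∧ (ω (h - (ω u).2)).1 ∈ W).card := by
    refine Finset.card_le_card_of_injOn (fun e => e.1) ?_ ?_
    · rintro ⟨u, w⟩ he
      simp only [Finset.coe_filter, Finset.mem_univ, true_and, Set.mem_ofPred_eq] at he ⊢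
      obtain ⟨h1, h2, h3⟩ := he
      rw [h2]
      exact ⟨h1, h3⟩
    · rintro ⟨u, w⟩ he ⟨u', w'⟩ he' heq
      simp only [Finset.coe_filter, Finset.mem_univ, true_and, Set.mem_ofPred_eq] at he he' heq
      subst heq
      rw [Prod.mk.injEq]
      exact ⟨rfl, he.2.1.symm.trans he'.2.1⟩
  refine h1.trans ?_
  rw [← Finset.sum_product', Finset.card_eq_sum_card_fiberwise (t := W ×ˢ W)
    (f := fun u => ((ω u).1, (ω (h - (ω u).2)).1))]
  · refine Finset.sum_le_sum fun x _ => Finset.card_le_card ?_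
    intro u
    simp only [Finset.mem_filter, Finset.mem_univ, true_and, Prod.ext_iff]
    tauto
  · intro u
    simp only [Finset.coe_filter, Finset.mem_univ, true_and, Set.mem_ofPred_eq, Finset.coe_product,
      Set.mem_prod, Finset.mem_coe]
    tauto

/-- The deterministic part. Chaining `hdeg` and `hsum` gives `colEdges / n ≤ 4D / (n q²) + 3Λ`, and
`hload` doubles this and adds `Λ`; whence the constants `8` and `7`. -/
lemma totalLoad_le_of_forall_le [NeZero n] [NeZero q] (ω : Fin n → Fin q × Fin n) {Λ : ℝ}
    (hΛ : 0 ≤ Λ)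
    (hdeg : ∀ v j, (colDeg adj (fun v => (ω v).1) v j : ℝ) ≤ 2 * ((outDeg adj v : ℝ) / q) + Λ)
    (hsum : ∀ i, (∑ v, if (ω v).1 = i then (outDeg adj v : ℝ) / n else 0) ≤
      2 * ((∑ u, (outDeg adj u : ℝ)) / (n * q)) + Λ)
    (hload : ∀ h i j, (load adj (fun v => (ω v).1) (fun v => (ω v).2) h i j : ℝ) ≤
      2 * ((colEdges adj (fun v => (ω v).1) i j : ℝ) / n) + Λ)
    (W : Finset (Fin q)) (h : Fin n) :
    (totalLoad adj ω W h : ℝ) ≤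
      (W.card : ℝ) ^ 2 * (8 * (∑ u, (outDeg adj u : ℝ)) / (n * (q : ℝ) ^ 2) + 7 * Λ) := by
  classical
  have hq1 : (1 : ℝ) ≤ q := by exact_mod_cast NeZero.one_le
  have hn : (0 : ℝ) < n := by exact_mod_cast NeZero.pos n
  set D := ∑ u, (outDeg adj u : ℝ) with hD
  have hedges : ∀ i j, (colEdges adj (fun v => (ω v).1) i j : ℝ) / n ≤
      4 * D / (n * (q : ℝ) ^ 2) + 3 * Λ := by
    intro i j
    have h1 : (colEdges adj (fun v => (ω v).1) i j : ℝ) ≤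
        (2 * n / q) * (∑ v, if (ω v).1 = i then (outDeg adj v : ℝ) / n else 0) + n * Λ := by
      rw [colEdges, Finset.mul_sum]
      push_cast
      calc ∑ u with (ω u).1 = i, (colDeg adj (fun v => (ω v).1) u j : ℝ)
          ≤ ∑ u with (ω u).1 = i, (2 * ((outDeg adj u : ℝ) / q) + Λ) :=
            Finset.sum_le_sum fun u _ => hdeg u j
        _ = ∑ u with (ω u).1 = i, 2 * ((outDeg adj u : ℝ) / q) +
            (Finset.univ.filter fun u => (ω u).1 = i).card * Λ := by
            rw [Finset.sum_add_distrib, Finset.sum_const, nsmul_eq_mul]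
        _ ≤ _ := by
            gcongr
            · rw [Finset.sum_filter]
              refine (Finset.sum_congr rfl fun u _ => ?_).le
              split_ifs
              · field_simp
              · simp
            · exact (Finset.card_le_univ _).trans_eq (Fintype.card_fin n)
    rw [div_le_iff₀ hn]
    have h2 : (2 * n / q : ℝ) * (∑ v, if (ω v).1 = i then (outDeg adj v : ℝ) / n else 0) ≤
        (2 * n / q : ℝ) * (2 * (D / (n * q)) + Λ) := by
      gcongr
      exact hsum i
    have h3 : (2 * n / q : ℝ) * (2 * (D / (n * q)) + Λ) = 4 * D / (q : ℝ) ^ 2 + n * (2 * Λ / q) := by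
      field_simp
      ring
    have h4 : (n : ℝ) * (2 * Λ / q) ≤ n * (2 * Λ) := by
      gcongr
      exact div_le_self (by positivity) hq1
    have h5 : (4 * D / (n * (q : ℝ) ^ 2) + 3 * Λ) * n = 4 * D / (q : ℝ) ^ 2 + 3 * Λ * n := by
      field_simp
    rw [h5]
    linarith
  calc (totalLoad adj ω W h : ℝ)
      ≤ ∑ i ∈ W, ∑ j ∈ W, (load adj (fun v => (ω v).1) (fun v => (ω v).2) h i j : ℝ) := by
        exact_mod_cast totalLoad_le adj ω W h
    _ ≤ ∑ _i ∈ W, ∑ _j ∈ W, (8 * D / (n * (q : ℝ) ^ 2) + 7 * Λ) := by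
        refine Finset.sum_le_sum fun i _ => Finset.sum_le_sum fun j _ => ?_
        have := hload h i j
        have := hedges i j
        have : 8 * D / (n * (q : ℝ) ^ 2) = 2 * (4 * D / (n * (q : ℝ) ^ 2)) := by ring
        linarith
    _ = _ := by
        simp only [Finset.sum_const, nsmul_eq_mul]
        ring

lemma card_lt_totalLoad_le [NeZero n] [NeZero q] (hqn : q ≤ n) {Λ : ℝ} (hΛ : 0 ≤ Λ) :
    (Nat.card {ω : Fin n → Fin q × Fin n // ∃ W h,
      (W.card : ℝ) ^ 2 * (8 * (∑ u, (outDeg adj u : ℝ)) / (n * (q : ℝ) ^ 2) + 7 * Λ) <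
        totalLoad adj ω W h} : ℝ) ≤
      3 * (n : ℝ) ^ 3 * (Real.exp (-Λ) * ((q : ℝ) * n) ^ n) := by
  classical
  set M := Real.exp (-Λ) * ((q : ℝ) * n) ^ n with hM
  have hM0 : 0 ≤ M := by positivity
  let A : Fin n × Fin q → Finset (Fin n → Fin q × Fin n) := fun x => Finset.univ.filter fun ω =>
    2 * ((outDeg adj x.1 : ℝ) / q) + Λ < colDeg adj (fun v => (ω v).1) x.1 x.2
  let B : Fin q → Finset (Fin n → Fin q × Fin n) := fun i => Finset.univ.filter fun ω =>
    2 * ((∑ u, (outDeg adj u : ℝ)) / (n * q)) + Λ <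
      ∑ v, if (ω v).1 = i then (outDeg adj v : ℝ) / n else 0
  let C : Fin n × Fin q × Fin q → Finset (Fin n → Fin q × Fin n) := fun x =>
    Finset.univ.filter fun ω => 2 * ((colEdges adj (fun v => (ω v).1) x.2.1 x.2.2 : ℝ) / n) + Λ <
      load adj (fun v => (ω v).1) (fun v => (ω v).2) x.1 x.2.1 x.2.2
  have hA : ∀ x, ((A x).card : ℝ) ≤ M := fun x => by
    have := card_lt_colDeg_le adj x.1 x.2 Λ
    rwa [Nat.card_eq_fintype_card, Fintype.card_subtype] at this
  have hB : ∀ x, ((B x).card : ℝ) ≤ M := fun x => by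
    have := card_lt_sum_outDeg_le adj x Λ
    rwa [Nat.card_eq_fintype_card, Fintype.card_subtype] at this
  have hC : ∀ x, ((C x).card : ℝ) ≤ M := fun x => by
    have := card_lt_load_le adj x.1 x.2.1 x.2.2 Λ
    rwa [Nat.card_eq_fintype_card, Fintype.card_subtype] at this
  -- Union bound over three families of bad events, each with at most `n ^ 3` members because `q ≤
  -- n`.
  have hunion : ∀ {ι : Type} [Fintype ι] (F : ι → Finset (Fin n → Fin q × Fin n)),
      (∀ x, ((F x).card : ℝ) ≤ M) →
      ((Finset.univ.biUnion F).card : ℝ) ≤ Fintype.card ι * M := by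
    intro ι _ F hF
    calc ((Finset.univ.biUnion F).card : ℝ) ≤ ∑ x, ((F x).card : ℝ) := by
          exact_mod_cast Finset.card_biUnion_le
      _ ≤ ∑ _x : ι, M := Finset.sum_le_sum fun x _ => hF x
      _ = _ := by simp
  rw [Nat.card_eq_fintype_card, Fintype.card_subtype]
  have hsub : (Finset.univ.filter fun ω : Fin n → Fin q × Fin n => ∃ W h,
      (W.card : ℝ) ^ 2 * (8 * (∑ u, (outDeg adj u : ℝ)) / (n * (q : ℝ) ^ 2) + 7 * Λ) <
        totalLoad adj ω W h) ⊆ Finset.univ.biUnion A ∪ (Finset.univ.biUnion B ∪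
          Finset.univ.biUnion C) := by
    intro ω hω
    obtain ⟨W, h, hWh⟩ := (Finset.mem_filter.1 hω).2
    by_contra hcon
    simp only [Finset.mem_union, Finset.mem_biUnion, Finset.mem_univ, true_and, not_or, not_exists,
      A, B, C, Finset.mem_filter, not_lt] at hcon
    obtain ⟨h1, h2, h3⟩ := hcon
    exact absurd hWh (not_lt.2 (totalLoad_le_of_forall_le adj ω hΛ (fun v j => h1 (v, j)) h2
      (fun h i j => h3 (h, i, j)) W h))
  have h1 := hunion A hA
  have h2 := hunion B hB
  have h3 := hunion C hC
  have hcard : ((Finset.univ.filter fun ω : Fin n → Fin q × Fin n => ∃ W h,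
      (W.card : ℝ) ^ 2 * (8 * (∑ u, (outDeg adj u : ℝ)) / (n * (q : ℝ) ^ 2) + 7 * Λ) <
        totalLoad adj ω W h).card : ℝ) ≤ (Finset.univ.biUnion A).card +
          ((Finset.univ.biUnion B).card + (Finset.univ.biUnion C).card) := by
    exact_mod_cast (Finset.card_le_card hsub).trans ((Finset.card_union_le _ _).trans
      (Nat.add_le_add_left (Finset.card_union_le _ _) _))
  have hn1 : (1 : ℝ) ≤ n := by exact_mod_cast NeZero.one_le
  have hq1 : (1 : ℝ) ≤ q := by exact_mod_cast NeZero.one_le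
  have hqn' : (q : ℝ) ≤ n := by exact_mod_cast hqn
  have e1 : (Fintype.card (Fin n × Fin q) : ℝ) ≤ (n : ℝ) ^ 3 := by
    simp only [Fintype.card_prod, Fintype.card_fin]; push_cast
    calc (n : ℝ) * q ≤ n * n := by gcongr
      _ ≤ n * n * n := le_mul_of_one_le_right (by positivity) hn1
      _ = _ := by ring
  have e2 : (Fintype.card (Fin q) : ℝ) ≤ (n : ℝ) ^ 3 := by
    simp only [Fintype.card_fin]
    calc (q : ℝ) ≤ n := hqn'
      _ ≤ _ := le_self_pow₀ hn1 (by norm_num)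
  have e3 : (Fintype.card (Fin n × Fin q × Fin q) : ℝ) ≤ (n : ℝ) ^ 3 := by
    simp only [Fintype.card_prod, Fintype.card_fin]; push_cast
    calc (n : ℝ) * (q * q) ≤ n * (n * n) := by gcongr
      _ = _ := by ring
  have := mul_le_mul_of_nonneg_right e1 hM0
  have := mul_le_mul_of_nonneg_right e2 hM0
  have := mul_le_mul_of_nonneg_right e3 hM0
  linarith

end Load

/-! ### Choice of the parameters and the upper bound -/

lemma exists_encoding {α : Type*} [Fintype α] [Nonempty α] {B : ℕ} (h : Fintype.card α ≤ 2 ^ B) :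
    ∃ (enc : α → BitVec B) (dec : BitVec B → α), ∀ x, dec (enc x) = x := by
  obtain ⟨f⟩ := Function.Embedding.nonempty_of_card_le (α := α) (β := Fin (2 ^ B)) (by simpa using h)
  have hinj : Function.Injective fun x => BitVec.ofFin (f x) := by
    intro x y hxy
    exact f.injective (BitVec.ofFin.inj hxy)
  exact ⟨_, Function.invFun _, Function.leftInverse_invFun hinj⟩

/-- A surjection from the nodes onto the `p`-tuples of colours exists as `q ^ p ≤ n`; a node wants
the entries of its tuple. The logarithmic bound makes the final constant independent of `p`: for `q
≥ 2` it follows from `2 ^ p ≤ q ^ p ≤ n`, and for `q = 1` there is just one colour. -/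
lemma exists_color_sets {n p q : ℕ} (hn : 2 ≤ n) (hq : q ≠ 0) (hqn : q ^ p ≤ n) :
    ∃ want : Fin n → Finset (Fin q),
      (∀ S : Finset (Fin q), S.card ≤ p → ∃ x, S ⊆ want x) ∧
      ∀ x, ((want x).card : ℝ) ≤ Real.logb 2 n := by
  classical
  have : NeZero q := ⟨hq⟩
  obtain ⟨f⟩ := Function.Embedding.nonempty_of_card_le (α := Fin p → Fin q) (β := Fin n)
    (by simpa using hqn)
  have hsurj : Function.Surjective (Function.invFun f) :=
    Function.invFun_surjective f.injective
  refine ⟨fun x => Finset.univ.image (Function.invFun f x), fun S hS => ?_, fun x => ?_⟩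
  · obtain ⟨e⟩ := Function.Embedding.nonempty_of_card_le (α := S) (β := Fin p) (by simpa using hS)
    obtain ⟨x, hx⟩ := hsurj (Function.extend e (fun s => (s : Fin q)) fun _ => 0)
    refine ⟨x, fun s hs => ?_⟩
    beta_reduce
    rw [hx]
    refine Finset.mem_image.2 ⟨e ⟨s, hs⟩, Finset.mem_univ _, ?_⟩
    rw [e.injective.extend_apply]
  · have hn0 : (0 : ℝ) < n := by positivity
    have h1 : (Finset.univ.image (Function.invFun f x)).card ≤ p :=
      Finset.card_image_le.trans (by simp)
    have h2 : (Finset.univ.image (Function.invFun f x)).card ≤ q :=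
      (Finset.card_le_univ _).trans (by simp)
    rw [Real.le_logb_iff_rpow_le (by norm_num) hn0, Real.rpow_natCast]
    have h3 : 2 ^ (Finset.univ.image (Function.invFun f x)).card ≤ n := by
      rcases Nat.lt_or_ge q 2 with hq2 | hq2
      · refine (Nat.pow_le_pow_right (by norm_num) (h2.trans (Nat.le_of_lt_succ hq2))).trans ?_
        simpa using hn
      · exact (Nat.pow_le_pow_right (by norm_num) h1).trans
          ((Nat.pow_le_pow_left hq2 p).trans hqn)
    exact_mod_cast h3

lemma exists_numColors {n p : ℕ} (hp : p ≠ 0) (hn : n ≠ 0) :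
    ∃ q : ℕ, q ≠ 0 ∧ q ^ p ≤ n ∧ (n : ℝ) ^ (2 / (p : ℝ)) ≤ 4 * (q : ℝ) ^ 2 := by
  have hn1 : (1 : ℝ) ≤ n := by exact_mod_cast Nat.one_le_iff_ne_zero.2 hn
  have hp0 : (0 : ℝ) < p := by exact_mod_cast Nat.pos_of_ne_zero hp
  set y := (n : ℝ) ^ (1 / (p : ℝ)) with hy
  have hy1 : 1 ≤ y := Real.one_le_rpow hn1 (by positivity)
  have hq1 : 1 ≤ ⌊y⌋₊ := Nat.le_floor (by simpa using hy1)
  refine ⟨⌊y⌋₊, by omega, ?_, ?_⟩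
  · have h1 : ((⌊y⌋₊ : ℝ)) ^ p ≤ y ^ p := by
      gcongr
      exact Nat.floor_le (by positivity)
    have h2 : y ^ p = n := by
      rw [hy, ← Real.rpow_natCast, ← Real.rpow_mul (by positivity)]
      field_simp
      simp
    rw [h2] at h1
    exact_mod_cast h1
  · have h1 : (n : ℝ) ^ (2 / (p : ℝ)) = y ^ 2 := by
      rw [hy, ← Real.rpow_natCast, ← Real.rpow_mul (by positivity)]
      congr 1
      push_cast
      ring
    have h2 : y ≤ 2 * (⌊y⌋₊ : ℝ) := by
      have := (Nat.lt_floor_add_one y).le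
      have : (1 : ℝ) ≤ ⌊y⌋₊ := by exact_mod_cast hq1
      linarith
    rw [h1]
    nlinarith

lemma sum_outDeg_adj {n : ℕ} (G : SimpleGraph (Fin n)) :
    ∑ u, outDeg G.Adj u = 2 * numEdges G := by
  classical
  rw [← Scheme.sum_ncard_neighborSet]
  refine Finset.sum_congr rfl fun u _ => ?_
  rw [outDeg, ← Set.ncard_coe_finset]
  congr 1
  ext w
  simp

lemma queueSet_table {n q : ℕ} (G : SimpleGraph (Fin n)) (ω : Fin n → Fin q × Fin n)
    (W : Finset (Fin q)) (h : Fin n) :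
    (queueSet W (Scheme.table G ω h)).card = totalLoad G.Adj ω W h := by
  rw [totalLoad]
  congr 1
  ext e
  rw [Scheme.mem_queueSet_table]
  simp

namespace Scheme

variable {n q B : ℕ} (P : Scheme n q B)

lemma faces_add_one : (P.faces : ℝ) + 1 = q * n := by
  have := Fintype.card_congr P.coin
  simp only [Fintype.card_fin, Fintype.card_prod] at this
  exact_mod_cast this

theorem law_listsBy_ge [NeZero n] [NeZero q] {p : ℕ} (G : SimpleGraph (Fin n)) (hqn : q ≤ n)
    {Λ ℓ : ℝ} (hΛ : 0 ≤ Λ)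
    (hwant : ∀ S : Finset (Fin q), S.card ≤ p → ∃ x, S ⊆ P.want x)
    (hcard : ∀ x, ((P.want x).card : ℝ) ≤ ℓ)
    (hrounds : ∀ D, P.rounds D = ⌊ℓ ^ 2 * (8 * (D : ℝ) / (n * (q : ℝ) ^ 2) + 7 * Λ)⌋₊) :
    1 - 3 * (n : ℝ) ^ 3 * Real.exp (-Λ) ≤
      (P.alg p).law.real {ω | (P.alg p).ListsBy p G ω (P.rounds (2 * numEdges G) + 1)} := by
  classical
  let bad : (Fin n → Fin q × Fin n) → Prop := fun ω => ∃ W h,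
      (W.card : ℝ) ^ 2 * (8 * (∑ u, (outDeg G.Adj u : ℝ)) / (n * (q : ℝ) ^ 2) + 7 * Λ) <
        totalLoad G.Adj ω W h
  let S : Finset (Fin n → Fin ((P.alg p).faces + 1)) :=
    Finset.univ.filter fun g => bad fun v => P.coin (g v)
  have hS : (S.card : ℝ) ≤ 3 * (n : ℝ) ^ 3 * (Real.exp (-Λ) * ((q : ℝ) * n) ^ n) := by
    refine le_trans (le_of_eq ?_) (card_lt_totalLoad_le G.Adj hqn hΛ)
    rw [← Fintype.card_subtype, ← Nat.card_eq_fintype_card]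
    congr 1
    exact Nat.card_congr ((Equiv.piCongrRight fun _ => P.coin).subtypeEquiv fun g => Iff.rfl)
  have hlaw : (P.alg p).law.real {ω | (fun v => ω (v, 0)) ∈ S} ≤
      3 * (n : ℝ) ^ 3 * Real.exp (-Λ) := by
    refine ((P.alg p).law_real_init_le S).trans ?_
    have hf : (((P.alg p).faces : ℝ) + 1) = q * n := P.faces_add_one
    have hq0 : (0 : ℝ) < q := by exact_mod_cast NeZero.pos q
    have hn0 : (0 : ℝ) < n := by exact_mod_cast NeZero.pos n
    rw [hf, div_le_iff₀ (by positivity)]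
    linarith
  set good : Set (P.alg p).Coins :=
    {ω | (P.alg p).ListsBy p G ω (P.rounds (2 * numEdges G) + 1)} with hgood
  have hcover : (Set.univ : Set (P.alg p).Coins) ⊆ good ∪ {ω | (fun v => ω (v, 0)) ∈ S} := by
    intro ω _
    by_cases hω : (fun v => ω (v, 0)) ∈ S
    · exact Or.inr hω
    · left
      refine P.listsBy p G ω hwant fun h x => ?_
      rw [queueSet_table, hrounds]
      have hω' : ¬ bad (P.coins p ω) := fun hb =>
        hω (Finset.mem_filter.2 ⟨Finset.mem_univ _, hb⟩)
      simp only [bad, not_exists, not_lt] at hω'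
      refine Nat.le_floor ((hω' (P.want x) h).trans ?_)
      have hD : (∑ u, (outDeg G.Adj u : ℝ)) = ((2 * numEdges G : ℕ) : ℝ) := by
        rw [← sum_outDeg_adj]; push_cast; rfl
      rw [hD]
      gcongr
      exact hcard x
  have h1 : (1 : ℝ) ≤ (P.alg p).law.real good +
      (P.alg p).law.real {ω | (fun v => ω (v, 0)) ∈ S} := by
    calc (1 : ℝ) = (P.alg p).law.real Set.univ := by simp
      _ ≤ _ := (measureReal_mono hcover).trans (measureReal_union_le _ _)
  linarith

end Scheme

theorem exists_listing_algorithm (a : ℕ) {p n : ℕ} (hp : 3 ≤ p) (hn : 2 ≤ n) :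
    ∃ A : Algorithm n (6 * Nat.clog 2 n), ∀ G : SimpleGraph (Fin n),
      1 - 1 / (n : ℝ) ^ a ≤ A.law.real {ω | ∃ t : ℕ,
        (t : ℝ) ≤ (100 + 7 * (a : ℝ)) * Real.logb 2 n ^ 3 * cost p n (numEdges G) ∧
          A.ListsBy p G ω t} := by
  obtain ⟨q, hq, hqn, hq2⟩ := exists_numColors (n := n) (p := p) (by omega) (by omega)
  have hqle : q ≤ n := (Nat.le_self_pow (by omega) q).trans hqn
  obtain ⟨want, hwant, hcard⟩ := exists_color_sets hn hq hqn
  have : NeZero n := ⟨by omega⟩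
  have : NeZero q := ⟨hq⟩
  have hB : n ^ 6 ≤ 2 ^ (6 * Nat.clog 2 n) := by
    rw [mul_comm, pow_mul]
    exact Nat.pow_le_pow_left (Nat.le_pow_clog (by norm_num) n) 6
  have hn1 : n + 1 ≤ n ^ 2 := by nlinarith
  obtain ⟨enc₁, dec₁, h₁⟩ := exists_encoding (α := Greeting n q) (B := 6 * Nat.clog 2 n) (by
    simp only [Fintype.card_prod, Fintype.card_fin, Fintype.card_option]
    refine le_trans ?_ hB
    calc q * ((n + 1) * (n + 1)) ≤ n ^ 2 * (n ^ 2 * n ^ 2) := by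
          gcongr
          exact hqle.trans (Nat.le_self_pow (by norm_num) n)
      _ = n ^ 6 := by ring)
  obtain ⟨enc₂, dec₂, h₂⟩ := exists_encoding (α := Fin n × Fin n) (B := 6 * Nat.clog 2 n) (by
    simp only [Fintype.card_prod, Fintype.card_fin]
    refine le_trans ?_ hB
    calc n * n = n ^ 2 := by ring
      _ ≤ n ^ 6 := Nat.pow_le_pow_right (by omega) (by norm_num))
  have hn0 : (0 : ℝ) < n := by positivity
  have hn2 : (2 : ℝ) ≤ n := by exact_mod_cast hn
  set ℓ := Real.logb 2 n with hℓ
  -- The failure probability `3 n³ exp (-Λ) = 3 n^(-a-2)` is then at most `n^(-a)`, as `3 ≤ n²`.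
  set Λ := ((a : ℝ) + 5) * Real.log n with hΛ
  have hlog0 : 0 ≤ Real.log n := Real.log_nonneg (by linarith)
  have hΛ0 : 0 ≤ Λ := by positivity
  have hℓ1 : 1 ≤ ℓ := by
    rw [hℓ, Real.le_logb_iff_rpow_le (by norm_num) hn0]
    simpa using hn2
  have hlogle : Real.log n ≤ ℓ := by
    rw [hℓ, Real.logb, le_div_iff₀ (Real.log_pos (by norm_num))]
    have : Real.log 2 ≤ 1 := by linarith [Real.log_two_lt_d9]
    nlinarith
  have hqpos : 0 < q * n := by positivity
  let P : Scheme n q (6 * Nat.clog 2 n) :=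
    { faces := q * n - 1
      coin := Fintype.equivOfCardEq (by simp; omega)
      want := want
      rounds := fun D => ⌊ℓ ^ 2 * (8 * (D : ℝ) / (n * (q : ℝ) ^ 2) + 7 * Λ)⌋₊
      encGreeting := enc₁
      decGreeting := dec₁
      decGreeting_encGreeting := h₁
      encEdge := enc₂
      decEdge := dec₂
      decEdge_encEdge := h₂ }
  refine ⟨P.alg p, fun G => ?_⟩
  have hprob := P.law_listsBy_ge (p := p) G hqle hΛ0 hwant hcard fun D => rfl
  have hexp : 3 * (n : ℝ) ^ 3 * Real.exp (-Λ) ≤ 1 / (n : ℝ) ^ a := by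
    have : Real.exp (-Λ) = 1 / (n : ℝ) ^ (a + 5) := by
      rw [Real.exp_neg, hΛ, mul_comm, Real.exp_mul, Real.exp_log hn0, one_div,
        ← Real.rpow_natCast]
      push_cast
      rfl
    rw [this, pow_add]
    have h3 : 3 * (n : ℝ) ^ 3 ≤ (n : ℝ) ^ 5 := by
      have : (n : ℝ) ^ 5 = (n : ℝ) ^ 2 * (n : ℝ) ^ 3 := by ring
      rw [this]
      gcongr
      nlinarith
    rw [mul_one_div, div_le_div_iff₀ (by positivity) (by positivity)]
    have : (0 : ℝ) ≤ (n : ℝ) ^ a := by positivity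
    nlinarith
  refine (sub_le_sub_left hexp 1).trans (hprob.trans (measureReal_mono ?_))
  intro ω hω
  refine ⟨_, ?_, hω⟩
  set m := numEdges G
  set x := (m : ℝ) / (n : ℝ) ^ (1 + 2 / (p : ℝ)) with hx
  have hx0 : 0 ≤ x := by positivity
  have hfl : (P.rounds (2 * m) : ℝ) ≤ ℓ ^ 2 * (8 * ((2 * m : ℕ) : ℝ) / (n * (q : ℝ) ^ 2) + 7 * Λ) :=
    Nat.floor_le (by positivity)
  have hdens : 8 * ((2 * m : ℕ) : ℝ) / (n * (q : ℝ) ^ 2) ≤ 64 * x := by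
    have hq0 : (0 : ℝ) < q := by exact_mod_cast NeZero.pos q
    rw [hx, Real.rpow_add hn0, Real.rpow_one, div_le_iff₀ (by positivity)]
    push_cast
    have e : 64 * ((m : ℝ) / (n * (n : ℝ) ^ (2 / (p : ℝ)))) * (n * (q : ℝ) ^ 2) =
        16 * m * (4 * (q : ℝ) ^ 2 / (n : ℝ) ^ (2 / (p : ℝ))) := by
      field_simp
      ring
    rw [e]
    have : 1 ≤ 4 * (q : ℝ) ^ 2 / (n : ℝ) ^ (2 / (p : ℝ)) := by
      rw [le_div_iff₀ (by positivity)]; linarith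
    have hm : (0 : ℝ) ≤ m := by positivity
    nlinarith
  push_cast
  have hΛℓ : Λ ≤ ((a : ℝ) + 5) * ℓ := mul_le_mul_of_nonneg_left hlogle (by positivity)
  have h3 : ℓ ^ 2 * (8 * ((2 * m : ℕ) : ℝ) / (n * (q : ℝ) ^ 2) + 7 * Λ) ≤
      ℓ ^ 2 * (64 * x * ℓ + 7 * (((a : ℝ) + 5) * ℓ)) := by
    gcongr
    exact hdens.trans (le_mul_of_one_le_right (by positivity) hℓ1)
  have h4 : (1 : ℝ) ≤ ℓ ^ 3 := one_le_pow₀ hℓ1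
  have h5 : cost p n m = 1 + x := rfl
  rw [h5]
  have h6 : 0 ≤ ℓ ^ 3 * ((36 + 7 * a) * x + 64) := by positivity
  nlinarith

/-! ### Counting cliques by edges -/

section CliqueTuples

variable {V : Type*} [Fintype V]

/-- Tuples of pairwise adjacent vertices. -/
abbrev CliqueTuple (H : SimpleGraph V) (p : ℕ) : Type _ :=
  {f : Fin p → V // ∀ i j, i ≠ j → H.Adj (f i) (f j)}

/-- The first two entries form a dart and the others a shorter tuple. This is the induction step, of
length two, so the bases `2` and `3` are both needed. -/
lemma card_cliqueTuple_add_two_le (H : SimpleGraph V) (p : ℕ) :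
    Nat.card (CliqueTuple H (p + 2)) ≤ Nat.card H.Dart * Nat.card (CliqueTuple H p) := by
  classical
  rw [← Nat.card_prod]
  refine Nat.card_le_card_of_injective (fun f => (⟨(f.1 0, f.1 1), f.2 0 1 (by simp)⟩,
    ⟨fun i => f.1 i.succ.succ, fun i j hij => f.2 _ _ (by simpa using hij)⟩)) ?_
  rintro ⟨f, hf⟩ ⟨g, hg⟩ h
  simp only [Prod.mk.injEq, SimpleGraph.Dart.mk.injEq, Subtype.mk.injEq] at h
  obtain ⟨⟨h0, h1⟩, h2⟩ := h
  rw [Subtype.mk.injEq]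
  funext i
  refine Fin.cases h0 (fun i => ?_) i
  refine Fin.cases h1 (fun i => ?_) i
  exact congrFun h2 i

lemma card_cliqueTuple_two_le (H : SimpleGraph V) :
    Nat.card (CliqueTuple H 2) ≤ Nat.card H.Dart := by
  classical
  refine Nat.card_le_card_of_injective (fun f => ⟨(f.1 0, f.1 1), f.2 0 1 (by simp)⟩) ?_
  rintro ⟨f, hf⟩ ⟨g, hg⟩ h
  simp only [SimpleGraph.Dart.mk.injEq, Prod.mk.injEq] at h
  rw [Subtype.mk.injEq]
  funext i
  fin_cases i
  · exact h.1
  · exact h.2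

/-- With `a` darts, the triangles at `v` number at most `(deg v)²` and at most `a`, hence at most
their geometric mean `deg v * √a`. Summing over `v` gives `a * √a`. -/
lemma card_cliqueTuple_three_sq_le (H : SimpleGraph V) :
    Nat.card (CliqueTuple H 3) ^ 2 ≤ Nat.card H.Dart ^ 3 := by
  classical
  let tri : V → Finset (V × V) := fun v =>
    Finset.univ.filter fun x => H.Adj v x.1 ∧ H.Adj v x.2 ∧ H.Adj x.1 x.2
  have h1 : Nat.card (CliqueTuple H 3) ≤ ∑ v, (tri v).card := by
    have : ∑ v, (tri v).card = Nat.card (Σ v, tri v) := by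
      rw [Nat.card_sigma]
      simp
    rw [this]
    refine Nat.card_le_card_of_injective (fun f => ⟨f.1 0, (f.1 1, f.1 2), by
      simp only [tri, Finset.mem_filter, Finset.mem_univ, true_and]
      exact ⟨f.2 _ _ (by decide), f.2 _ _ (by decide), f.2 _ _ (by decide)⟩⟩) ?_
    rintro ⟨f, hf⟩ ⟨g, hg⟩ h
    rw [Sigma.mk.injEq] at h
    obtain ⟨h0, h'⟩ := h
    rw [Subtype.heq_iff_coe_eq (by intro x; rw [h0])] at h'
    simp only [Prod.mk.injEq] at h'
    rw [Subtype.mk.injEq]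
    funext i
    fin_cases i
    · exact h0
    · exact h'.1
    · exact h'.2
  have hdart : Nat.card H.Dart = ∑ v, H.degree v := by
    rw [Nat.card_eq_fintype_card, H.dart_card_eq_sum_degrees]
  set a := Nat.card H.Dart with ha
  have h2 : ∀ v, (tri v).card ≤ H.degree v * H.degree v := by
    intro v
    rw [← H.card_neighborFinset_eq_degree, ← Finset.card_product]
    refine Finset.card_le_card fun x hx => ?_
    simp only [tri, Finset.mem_filter, Finset.mem_univ, true_and] at hx
    simp [hx.1, hx.2.1]
  have h3 : ∀ v, (tri v).card ≤ a := by
    intro v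
    have hcard : (tri v).card = Nat.card (tri v) := by simp
    rw [ha, hcard]
    refine Nat.card_le_card_of_injective (fun x => ⟨x.1, ?_⟩) ?_
    · have := x.2
      simp only [tri, Finset.mem_filter, Finset.mem_univ, true_and] at this
      exact this.2.2
    · rintro ⟨x, hx⟩ ⟨y, hy⟩ hxy
      simpa using hxy
  have h4 : ∀ v, ((tri v).card : ℝ) ≤ H.degree v * √a := by
    intro v
    refine le_of_sq_le_sq ?_ (by positivity)
    rw [mul_pow, Real.sq_sqrt (by positivity)]
    have := Nat.mul_le_mul (h2 v) (h3 v)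
    have : ((tri v).card : ℝ) * (tri v).card ≤ H.degree v * H.degree v * a := by exact_mod_cast this
    nlinarith
  have h5 : (Nat.card (CliqueTuple H 3) : ℝ) ≤ a * √a := by
    calc (Nat.card (CliqueTuple H 3) : ℝ) ≤ ∑ v, ((tri v).card : ℝ) := by exact_mod_cast h1
      _ ≤ ∑ v, (H.degree v : ℝ) * √a := Finset.sum_le_sum fun v _ => h4 v
      _ = a * √a := by rw [← Finset.sum_mul, hdart]; push_cast; rfl
  have h6 : (Nat.card (CliqueTuple H 3) : ℝ) ^ 2 ≤ (a : ℝ) ^ 3 := by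
    calc (Nat.card (CliqueTuple H 3) : ℝ) ^ 2 ≤ (a * √a) ^ 2 := by gcongr
      _ = (a : ℝ) ^ 3 := by rw [mul_pow, Real.sq_sqrt (by positivity)]; ring
  exact_mod_cast h6

/-- A graph with `a` darts has at most `a ^ (p / 2)` ordered `p`-cliques. -/
lemma card_cliqueTuple_sq_le (H : SimpleGraph V) (p : ℕ) (hp : 2 ≤ p) :
    Nat.card (CliqueTuple H p) ^ 2 ≤ Nat.card H.Dart ^ p := by
  obtain ⟨k, rfl⟩ := Nat.exists_eq_add_of_le' hp
  clear hp
  induction k using Nat.twoStepInduction with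
  | zero => exact Nat.pow_le_pow_left (card_cliqueTuple_two_le H) 2
  | one => exact card_cliqueTuple_three_sq_le H
  | more k ih _ =>
    calc Nat.card (CliqueTuple H (k + 2 + 2)) ^ 2
        ≤ (Nat.card H.Dart * Nat.card (CliqueTuple H (k + 2))) ^ 2 :=
          Nat.pow_le_pow_left (card_cliqueTuple_add_two_le H (k + 2)) 2
      _ = Nat.card H.Dart ^ 2 * Nat.card (CliqueTuple H (k + 2)) ^ 2 := by ring
      _ ≤ Nat.card H.Dart ^ 2 * Nat.card H.Dart ^ (k + 2) := Nat.mul_le_mul_left _ ih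
      _ = _ := by ring

lemma factorial_mul_card_le_card_cliqueTuple (H : SimpleGraph V) (p : ℕ) (L : Finset (Finset V))
    (hL : ∀ S ∈ L, H.IsNClique p S) : p.factorial * L.card ≤ Nat.card (CliqueTuple H p) := by
  classical
  have : Nat.card (Σ S : L, (Fin p ≃ S.1)) = p.factorial * L.card := by
    rw [Nat.card_sigma]
    have : ∀ S : L, Nat.card (Fin p ≃ S.1) = p.factorial := by
      intro S
      have e : Fin p ≃ S.1 := Fintype.equivOfCardEq (by simp [(hL S.1 S.2).card_eq])
      rw [Nat.card_eq_fintype_card, Fintype.card_equiv e, Fintype.card_fin]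
    simp only [this]
    simp [mul_comm]
  rw [← this]
  refine Nat.card_le_card_of_injective (fun x => ⟨fun i => (x.2 i : V), fun i j hij =>
    (hL x.1.1 x.1.2).isClique (x.2 i).2 (x.2 j).2 fun h => hij (x.2.injective (Subtype.ext h))⟩) ?_
  rintro ⟨⟨S, hS⟩, e⟩ ⟨⟨S', hS'⟩, e'⟩ h
  simp only [Subtype.mk.injEq] at h
  have hSS : S = S' := by
    ext v
    constructor
    · intro hv
      have := congrFun h (e.symm ⟨v, hv⟩)
      simp only [Equiv.apply_symm_apply] at this
      rw [this]
      exact (e' _).2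
    · intro hv
      have := congrFun h (e'.symm ⟨v, hv⟩)
      simp only [Equiv.apply_symm_apply] at this
      rw [← this]
      exact (e _).2
  subst hSS
  have : e = e' := by
    ext i
    exact congrFun h i
  rw [this]

lemma factorial_mul_card_sq_le (H : SimpleGraph V) {p : ℕ} (hp : 2 ≤ p) (L : Finset (Finset V))
    (hL : ∀ S ∈ L, H.IsNClique p S) :
    (p.factorial * L.card) ^ 2 ≤ (2 * H.edgeSet.ncard) ^ p := by
  classical
  refine (Nat.pow_le_pow_left (factorial_mul_card_le_card_cliqueTuple H p L hL) 2).trans ?_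
  refine (card_cliqueTuple_sq_le H p hp).trans_eq ?_
  rw [Nat.card_eq_fintype_card, H.dart_card_eq_twice_card_edges, ← SimpleGraph.coe_edgeFinset,
    Set.ncard_coe_finset]

end CliqueTuples

/-! ### Complete graphs with one edge deleted per block -/

/-- The number of functions that avoid a given set of pairs. -/
lemma card_avoid_le {κ : Type*} [Fintype κ] {s : ℕ} (hs : s ≠ 0) (D : Finset (κ × Fin s)) :
    (Nat.card {f : κ → Fin s // ∀ x ∈ D, f x.1 ≠ x.2} : ℝ) ≤
      (s : ℝ) ^ Fintype.card κ * Real.exp (-(D.card / s)) := by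
  classical
  have hs0 : (0 : ℝ) < s := by exact_mod_cast Nat.pos_of_ne_zero hs
  let T : κ → Finset (Fin s) := fun k => Finset.univ.filter fun j => (k, j) ∈ D
  have h1 : Nat.card {f : κ → Fin s // ∀ x ∈ D, f x.1 ≠ x.2} = ∏ k, (T k)ᶜ.card := by
    rw [← Fintype.card_piFinset, Nat.card_eq_fintype_card, Fintype.card_subtype]
    congr 1
    ext f
    simp only [Finset.mem_filter, Finset.mem_univ, true_and, Fintype.mem_piFinset,
      Finset.mem_compl, T]
    constructor
    · intro h k hk
      exact h _ hk rfl
    · rintro h ⟨k, j⟩ hx hkj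
      have hkj : f k = j := hkj
      exact h k (by rwa [hkj])
  have h2 : ∑ k, (T k).card = D.card := by
    rw [Finset.card_eq_sum_card_fiberwise (s := D) (t := Finset.univ) (f := Prod.fst)
      (fun _ _ => Finset.mem_coe.2 (Finset.mem_univ _))]
    refine Finset.sum_congr rfl fun k _ => ?_
    refine Finset.card_bij (fun j _ => (k, j)) ?_ ?_ ?_
    · intro j hj
      simpa [T] using hj
    · intro j _ j' _ h
      simpa using h
    · rintro ⟨k', j⟩ hx
      obtain ⟨hx, rfl⟩ := Finset.mem_filter.1 hx
      exact ⟨j, by simpa [T] using hx, rfl⟩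
  have h3 : ∀ k, ((T k)ᶜ.card : ℝ) ≤ s * Real.exp (-((T k).card / s)) := by
    intro k
    have hle : (T k).card ≤ s := (Finset.card_le_univ _).trans_eq (Fintype.card_fin s)
    rw [Finset.card_compl, Fintype.card_fin, Nat.cast_sub hle]
    have := Real.add_one_le_exp (-((T k).card / s : ℝ))
    calc (s : ℝ) - (T k).card = s * (-((T k).card / s : ℝ) + 1) := by field_simp; ring
      _ ≤ _ := by gcongr
  rw [h1]
  push_cast
  refine (Finset.prod_le_prod (fun k _ => by positivity) fun k _ => h3 k).trans_eq ?_
  rw [Finset.prod_mul_distrib, ← Real.exp_sum, Finset.prod_const, Finset.card_univ,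
    Finset.sum_neg_distrib, ← Finset.sum_div, ← h2]
  push_cast
  rfl

section HoleGraph

variable {V : Type*}

/-- The graph whose edges are all pairs of vertices in `U`. -/
def completeOn (U : Finset V) : SimpleGraph V where
  Adj u v := u ≠ v ∧ u ∈ U ∧ v ∈ U
  symm := ⟨fun _ _ h => ⟨h.1.symm, h.2.2, h.2.1⟩⟩
  loopless := ⟨fun _ h => h.1 rfl⟩

lemma ncard_edgeSet_completeOn [DecidableEq V] (U : Finset V) :
    (completeOn U).edgeSet.ncard = U.card.choose 2 := by
  rw [← Sym2.card_image_offDiag, ← Set.ncard_coe_finset]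
  congr 1
  ext e
  induction e with | _ u v
  simp only [completeOn, SimpleGraph.mem_edgeSet, ne_eq, Finset.coe_image, Finset.coe_offDiag,
    Set.mem_image, Set.mem_offDiag, Finset.mem_coe, Prod.exists]
  constructor
  · rintro ⟨h1, h2, h3⟩
    exact ⟨u, v, ⟨h2, h3, h1⟩, rfl⟩
  · rintro ⟨a, b, ⟨h1, h2, h3⟩, h⟩
    rcases Sym2.eq_iff.1 h with ⟨rfl, rfl⟩ | ⟨rfl, rfl⟩
    · exact ⟨h3, h1, h2⟩
    · exact ⟨fun h => h3 h.symm, h2, h1⟩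

variable {κ : Type*} {s : ℕ}

/-- The complete graph on `U`, whose edges are grouped into blocks by `g`, with the edge number
`f k` of every block `k` removed. -/
def holeGraph (U : Finset V) (g : Sym2 V → κ × Fin s) (f : κ → Fin s) : SimpleGraph V :=
  (completeOn U).deleteEdges {e | f (g e).1 = (g e).2}

variable {U : Finset V} {g : Sym2 V → κ × Fin s}

/-- A hole is determined by its block, because `f` fixes its position there and `g` is injective. -/
lemma ncard_holes_le [Fintype κ] (hg : Set.InjOn g (completeOn U).edgeSet) (f : κ → Fin s) :
    ((completeOn U).edgeSet ∩ {e | f (g e).1 = (g e).2}).ncard ≤ Fintype.card κ := by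
  have : ((completeOn U).edgeSet ∩ {e | f (g e).1 = (g e).2}).ncard ≤
      (Set.univ : Set κ).ncard := by
    refine Set.ncard_le_ncard_of_injOn (fun e => (g e).1) (fun _ _ => Set.mem_univ _) ?_
      (Set.toFinite _)
    intro e he e' he' h
    have h1 : f (g e).1 = (g e).2 := he.2
    have h2 : f (g e').1 = (g e').2 := he'.2
    refine hg he.1 he'.1 (Prod.ext h ?_)
    rw [← h1, ← h2]
    exact congrArg f h
  simpa [Set.ncard_univ] using this

lemma le_ncard_edgeSet_holeGraph_add [Fintype V] [DecidableEq V] [Fintype κ]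
    (hg : Set.InjOn g (completeOn U).edgeSet) (f : κ → Fin s) :
    U.card.choose 2 ≤ (holeGraph U g f).edgeSet.ncard + Fintype.card κ := by
  have h := ncard_holes_le hg f
  rw [holeGraph, SimpleGraph.edgeSet_deleteEdges, ← ncard_edgeSet_completeOn]
  have := Set.ncard_inter_add_ncard_sdiff_eq_ncard (completeOn U).edgeSet
    {e | f (g e).1 = (g e).2} (Set.toFinite _)
  omega

lemma ncard_edgeSet_holeGraph_le [Fintype V] [DecidableEq V] (g : Sym2 V → κ × Fin s) (f : κ → Fin s) :
    (holeGraph U g f).edgeSet.ncard ≤ U.card.choose 2 := by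
  rw [holeGraph, SimpleGraph.edgeSet_deleteEdges, ← ncard_edgeSet_completeOn]
  exact Set.ncard_le_ncard Set.sdiff_subset (Set.toFinite _)

lemma card_filter_pair_subset_le [DecidableEq V] {u v : V} (huv : u ≠ v) (hu : u ∈ U)
    (hv : v ∈ U) {p : ℕ} :
    ((U.powersetCard p).filter fun S => u ∈ S ∧ v ∈ S).card ≤ (U.card - 2).choose (p - 2) := by
  have h1 : (U \ {u, v}).card = U.card - 2 := by
    rw [Finset.card_sdiff_of_subset (by intro x; simp; rintro (rfl | rfl) <;> assumption),
      Finset.card_pair huv]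
  rw [← h1, ← Finset.card_powersetCard]
  refine Finset.card_le_card_of_injOn (fun S => S \ {u, v}) ?_ ?_
  · intro S hS
    simp only [Finset.coe_filter, Finset.mem_powersetCard, Set.mem_ofPred_eq, Finset.mem_coe]
      at hS ⊢
    refine ⟨Finset.sdiff_subset_sdiff hS.1.1 le_rfl, ?_⟩
    rw [Finset.card_sdiff_of_subset (by intro x; simp; rintro (rfl | rfl); exacts [hS.2.1, hS.2.2]),
      Finset.card_pair huv, hS.1.2]
  · intro S hS S' hS' h
    simp only [Finset.coe_filter, Set.mem_ofPred_eq] at hS hS' h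
    have e : ∀ T : Finset V, u ∈ T → v ∈ T → T = T \ {u, v} ∪ {u, v} := by
      intro T hu hv
      rw [Finset.sdiff_union_of_subset]
      intro x; simp; rintro (rfl | rfl) <;> assumption
    rw [e S hS.2.1 hS.2.2, e S' hS'.2.1 hS'.2.2, h]

lemma choose_le_ncard_cliqueSet_add [Fintype V] [DecidableEq V] [Fintype κ]
    (hg : Set.InjOn g (completeOn U).edgeSet) (f : κ → Fin s) (p : ℕ) :
    U.card.choose p ≤ ((holeGraph U g f).cliqueSet p).ncard +
      Fintype.card κ * (U.card - 2).choose (p - 2) := by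
  classical
  set X := (completeOn U).edgeSet ∩ {e | f (g e).1 = (g e).2} with hX
  let F : Sym2 V → Finset (Finset V) := fun e => (U.powersetCard p).filter fun S =>
    ∀ x ∈ e, x ∈ S
  have hF : ∀ e ∈ X.toFinset, (F e).card ≤ (U.card - 2).choose (p - 2) := by
    intro e he
    rw [Set.mem_toFinset] at he
    have he := he.1
    induction e with | _ u v
    have := card_filter_pair_subset_le (p := p) he.1 he.2.1 he.2.2
    simpa [F] using this
  have hcover : U.powersetCard p ⊆ ((holeGraph U g f).cliqueSet p).toFinset ∪
      X.toFinset.biUnion F := by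
    intro S hS
    have hS' := Finset.mem_powersetCard.1 hS
    rw [Finset.mem_union, Set.mem_toFinset, SimpleGraph.mem_cliqueSet_iff]
    by_contra hcon
    rw [not_or] at hcon
    refine hcon.1 ⟨fun u hu v hv huv => ?_, hS'.2⟩
    rw [holeGraph, SimpleGraph.deleteEdges_adj]
    have hadj : (completeOn U).Adj u v := ⟨huv, hS'.1 hu, hS'.1 hv⟩
    refine ⟨hadj, fun hhole => hcon.2 (Finset.mem_biUnion.2 ⟨s(u, v), ?_, ?_⟩)⟩
    · rw [Set.mem_toFinset]
      exact ⟨hadj, hhole⟩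
    · simp only [F, Finset.mem_filter]
      refine ⟨hS, fun x hx => ?_⟩
      rcases Sym2.mem_iff.1 hx with rfl | rfl
      · exact hu
      · exact hv
  have h1 := (Finset.card_le_card hcover).trans (Finset.card_union_le _ _)
  rw [Finset.card_powersetCard, ← Set.ncard_eq_toFinset_card'] at h1
  have h2 := (Finset.card_biUnion_le_card_mul X.toFinset F _ hF)
  rw [← Set.ncard_eq_toFinset_card'] at h2
  have h3 : X.ncard * _ ≤ _ := Nat.mul_le_mul_right ((U.card - 2).choose (p - 2)) (ncard_holes_le hg f)
  omega

/-- A hole destroys at most a fraction `p.choose 2 / N.choose 2` of the `p`-subsets of `U`, where `N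
= U.card`; by `hκ` all holes together destroy at most half. -/
lemma choose_le_two_mul_ncard_cliqueSet [Fintype V] [DecidableEq V] [Fintype κ]
    (hg : Set.InjOn g (completeOn U).edgeSet) (f : κ → Fin s) {p : ℕ} (hp : 2 ≤ p) (hpU : p ≤ U.card)
    (hκ : 2 * (Fintype.card κ * p.choose 2) ≤ U.card.choose 2) :
    U.card.choose p ≤ 2 * ((holeGraph U g f).cliqueSet p).ncard := by
  have h1 := choose_le_ncard_cliqueSet_add hg f p
  have h2 := Nat.choose_mul (n := U.card) hp
  have h3 : 0 < U.card.choose 2 := Nat.choose_pos (hp.trans hpU)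
  set N := U.card
  set R := (N - 2).choose (p - 2)
  have h4 : 2 * (Fintype.card κ * R) * N.choose 2 ≤ N.choose p * N.choose 2 := by
    calc 2 * (Fintype.card κ * R) * N.choose 2 = 2 * Fintype.card κ * (N.choose 2 * R) := by ring
      _ = 2 * (Fintype.card κ * p.choose 2) * N.choose p := by rw [← h2]; ring
      _ ≤ N.choose 2 * N.choose p := Nat.mul_le_mul_right _ hκ
      _ = _ := by ring
  have h5 := Nat.le_of_mul_le_mul_right h4 h3
  omega

/-- The graph `H` spanned by the cliques in `L` must avoid all holes. By the clique count it has at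
least `d` edges, and each of them excludes one value of `f` on its block. -/
lemma card_forall_isNClique_holeGraph_le [Fintype V] [DecidableEq V] [Fintype κ]
    (hg : Set.InjOn g (completeOn U).edgeSet) (hs : s ≠ 0) {p : ℕ} (hp : 2 ≤ p)
    (L : Finset (Finset V)) {d : ℝ}
    (hd : (2 * d) ^ p ≤ ((p.factorial : ℝ) * L.card) ^ 2) :
    (Nat.card {f : κ → Fin s // ∀ S ∈ L, (holeGraph U g f).IsNClique p S} : ℝ) ≤
      (s : ℝ) ^ Fintype.card κ * Real.exp (-(d / s)) := by
  classical
  -- A single admissible `f₀` is needed to know that `H` lies inside `completeOn U`, where `g` is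
  -- injective, and that the members of `L` have size `p`.
  rcases isEmpty_or_nonempty {f : κ → Fin s // ∀ S ∈ L, (holeGraph U g f).IsNClique p S} with
    hemp | ⟨⟨f₀, hf₀⟩⟩
  · simp only [Nat.card_of_isEmpty, Nat.cast_zero]
    positivity
  let H : SimpleGraph V :=
    { Adj := fun u v => u ≠ v ∧ ∃ S ∈ L, u ∈ S ∧ v ∈ S
      symm := ⟨fun _ _ h => ⟨h.1.symm, h.2.imp fun S hS => ⟨hS.1, hS.2.2, hS.2.1⟩⟩⟩
      loopless := ⟨fun _ h => h.1 rfl⟩ }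
  have hle : ∀ f : κ → Fin s, (∀ S ∈ L, (holeGraph U g f).IsNClique p S) →
      H ≤ holeGraph U g f := by
    rintro f hf u v ⟨huv, S, hS, hu, hv⟩
    exact (hf S hS).isClique hu hv huv
  have hHU : H.edgeSet ⊆ (completeOn U).edgeSet :=
    SimpleGraph.edgeSet_mono ((hle f₀ hf₀).trans (SimpleGraph.deleteEdges_le _))
  have hHL : ∀ S ∈ L, H.IsNClique p S := fun S hS =>
    ⟨fun u hu v hv huv => ⟨huv, S, hS, hu, hv⟩, (hf₀ S hS).card_eq⟩
  have hedges := factorial_mul_card_sq_le H hp L hHL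
  have hdle : d ≤ H.edgeSet.ncard := by
    have h1 : (2 * d) ^ p ≤ (2 * (H.edgeSet.ncard : ℝ)) ^ p := hd.trans (by exact_mod_cast hedges)
    have := le_of_pow_le_pow_left₀ (by omega) (by positivity) h1
    linarith
  have havoid : Nat.card {f : κ → Fin s // ∀ S ∈ L, (holeGraph U g f).IsNClique p S} ≤
      Nat.card {f : κ → Fin s // ∀ x ∈ H.edgeSet.toFinset.image g, f x.1 ≠ x.2} := by
    refine Nat.card_le_card_of_injective (fun f => ⟨f.1, ?_⟩) ?_
    · intro x hx
      obtain ⟨e, he, rfl⟩ := Finset.mem_image.1 hx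
      have he' := SimpleGraph.edgeSet_mono (hle f.1 f.2) (Set.mem_toFinset.1 he)
      rw [holeGraph, SimpleGraph.edgeSet_deleteEdges] at he'
      exact he'.2
    · intro f f' h
      exact Subtype.ext (congrArg (fun x => x.1) h)
  have hcard : (H.edgeSet.toFinset.image g).card = H.edgeSet.ncard := by
    rw [Finset.card_image_of_injOn (by simpa using hg.mono hHU), Set.ncard_eq_toFinset_card']
  calc (Nat.card {f : κ → Fin s // ∀ S ∈ L, (holeGraph U g f).IsNClique p S} : ℝ)
      ≤ Nat.card {f : κ → Fin s // ∀ x ∈ H.edgeSet.toFinset.image g, f x.1 ≠ x.2} := by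
        exact_mod_cast havoid
    _ ≤ _ := card_avoid_le hs _
    _ ≤ _ := by
        rw [hcard]
        gcongr

end HoleGraph

/-! ### Counting transcripts -/

namespace Algorithm

variable {n B p : ℕ} (A : Algorithm n B)

/-- The state of a node is determined by its neighbours and the messages that it receives. -/
lemma exists_replay (ω : A.Coins) (x : Fin n) (t : ℕ) :
    ∃ F : Set (Fin n) × (Fin t → Fin n → Option (BitVec B)) → A.State,
      ∀ G : SimpleGraph (Fin n), ∃ c, A.run G ω t x = F c := by
  induction t with
  | zero => exact ⟨fun c => A.init x c.1 (ω (x, 0)), fun G => ⟨(G.neighborSet x, finZeroElim), rfl⟩⟩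
  | succ t ih =>
    obtain ⟨F, hF⟩ := ih
    refine ⟨fun c => if (A.output (F (c.1, Fin.init c.2))).isSome then F (c.1, Fin.init c.2) else
      A.next (F (c.1, Fin.init c.2)) (c.2 (Fin.last t)) (ω (x, t + 1)), fun G => ?_⟩
    obtain ⟨c, hc⟩ := hF G
    refine ⟨(c.1, Fin.snoc (α := fun _ => Fin n → Option (BitVec B)) c.2 fun u =>
      if (A.output (A.run G ω t u)).isSome then none else A.send (A.run G ω t u) x), ?_⟩
    simp only [Fin.init_snoc, Fin.snoc_last]
    rw [run, hc]

lemma card_code (n B t : ℕ) :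
    Nat.card (Set (Fin n) × (Fin t → Fin n → Option (BitVec B))) =
      2 ^ n * (2 ^ B + 1) ^ (n * t) := by
  have hB : Nat.card (BitVec B) = 2 ^ B := by
    rw [Nat.card_congr BitVec.equivFin.toEquiv, Nat.card_fin]
  have hO : Nat.card (Option (BitVec B)) = 2 ^ B + 1 := by
    rw [Finite.card_option, hB]
  have hS : Nat.card (Set (Fin n)) = 2 ^ n := by
    rw [Nat.card_eq_fintype_card, Fintype.card_set, Fintype.card_fin]
  rw [Nat.card_prod, hS, Nat.card_fun, Nat.card_fun, hO, Nat.card_fin, Nat.card_fin, pow_mul]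

/-- A deterministic algorithm can list the cliques of only few members of a family of graphs. -/
lemma card_listsBy_le {Φ : Type*} [Fintype Φ] (Gr : Φ → SimpleGraph (Fin n)) (ω : A.Coins) (t : ℕ)
    (Q β : ℝ) (hQ : ∀ f, Q ≤ ((Gr f).cliqueSet p).ncard)
    (hβ : ∀ L : Finset (Finset (Fin n)), Q ≤ n * L.card →
      (Nat.card {f // ∀ S ∈ L, (Gr f).IsNClique p S} : ℝ) ≤ β) (hβ0 : 0 ≤ β) (hn : n ≠ 0) :
    (Nat.card {f // A.ListsBy p (Gr f) ω t} : ℝ) ≤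
      n * (2 ^ n * ((2 : ℝ) ^ B + 1) ^ (n * t)) * β := by
  classical
  choose F hF using fun x => A.exists_replay ω x t
  let C : Type := Set (Fin n) × (Fin t → Fin n → Option (BitVec B))
  have : Finite (BitVec B) := Finite.of_equiv _ BitVec.equivFin.toEquiv.symm
  have : Fintype C := Fintype.ofFinite C
  let L : Fin n × C → Finset (Finset (Fin n)) := fun y =>
    ((A.output (F y.1 y.2)).getD ∅).toFinset
  let T : Finset (Fin n × C) := Finset.univ.filter fun y => Q ≤ n * (L y).card
  have hcover : (Finset.univ.filter fun f => A.ListsBy p (Gr f) ω t) ⊆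
      T.biUnion fun y => Finset.univ.filter fun f => ∀ S ∈ L y, (Gr f).IsNClique p S := by
    intro f hf
    have hf := (Finset.mem_filter.1 hf).2
    choose c hc using fun x => hF x (Gr f)
    have hL : ∀ x S, S ∈ L (x, c x) → (Gr f).IsNClique p S := by
      intro x S hS
      simp only [L, ← hc, Set.mem_toFinset] at hS
      rw [← SimpleGraph.mem_cliqueSet_iff, ← hf.2]
      obtain ⟨O, hO⟩ := Option.isSome_iff_exists.1 (hf.1 x)
      rw [hO] at hS
      exact ⟨x, O, hO, hS⟩
    have hsum : ((Gr f).cliqueSet p).ncard ≤ ∑ x, (L (x, c x)).card := by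
      rw [Set.ncard_eq_toFinset_card']
      refine le_trans (Finset.card_le_card ?_) Finset.card_biUnion_le
      intro S hS
      rw [Set.mem_toFinset, ← hf.2] at hS
      obtain ⟨x, O, hO, hS⟩ := hS
      refine Finset.mem_biUnion.2 ⟨x, Finset.mem_univ _, ?_⟩
      simp only [L, ← hc, Set.mem_toFinset, hO]
      exact hS
    -- Pigeonhole: some node lists at least the average number of cliques.
    have hex : ∃ x, Q ≤ n * ((L (x, c x)).card : ℝ) := by
      by_contra! hcon
      have hn0 : (0 : ℝ) < n := by exact_mod_cast Nat.pos_of_ne_zero hn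
      have : NeZero n := ⟨hn⟩
      have h1 : ∑ x, (n * ((L (x, c x)).card : ℝ)) < ∑ _x : Fin n, Q :=
        Finset.sum_lt_sum_of_nonempty Finset.univ_nonempty fun x _ => hcon x
      rw [← Finset.mul_sum, Finset.sum_const, Finset.card_univ, Fintype.card_fin, nsmul_eq_mul]
        at h1
      have h2 := (hQ f).trans (by exact_mod_cast hsum : _ ≤ ∑ x, ((L (x, c x)).card : ℝ))
      exact absurd (lt_of_mul_lt_mul_left h1 hn0.le) (not_lt.2 h2)
    obtain ⟨x, hx⟩ := hex
    exact Finset.mem_biUnion.2 ⟨(x, c x), Finset.mem_filter.2 ⟨Finset.mem_univ _, hx⟩,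
      Finset.mem_filter.2 ⟨Finset.mem_univ _, hL x⟩⟩
  have hT : (T.card : ℝ) ≤ n * (2 ^ n * ((2 : ℝ) ^ B + 1) ^ (n * t)) := by
    have h1 : T.card ≤ n * (2 ^ n * (2 ^ B + 1) ^ (n * t)) := by
      refine (Finset.card_le_univ _).trans_eq ?_
      rw [← Nat.card_eq_fintype_card, Nat.card_prod, Nat.card_fin, card_code]
    exact_mod_cast h1
  rw [Nat.card_eq_fintype_card, Fintype.card_subtype]
  calc ((Finset.univ.filter fun f => A.ListsBy p (Gr f) ω t).card : ℝ)
      ≤ ∑ y ∈ T, ((Finset.univ.filter fun f => ∀ S ∈ L y, (Gr f).IsNClique p S).card : ℝ) := by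
        exact_mod_cast (Finset.card_le_card hcover).trans Finset.card_biUnion_le
    _ ≤ ∑ _y ∈ T, β := by
        refine Finset.sum_le_sum fun y hy => ?_
        have := hβ (L y) (Finset.mem_filter.1 hy).2
        rwa [Nat.card_eq_fintype_card, Fintype.card_subtype] at this
    _ = T.card * β := by simp
    _ ≤ _ := by gcongr

end Algorithm

/-! ### At least one round is needed; fixing the coins -/

lemma exists_graph_with_clique {n p m : ℕ} (hpn : p ≤ n) (hm : p.choose 2 ≤ m)
    (hmn : m ≤ n.choose 2) :
    ∃ (G : SimpleGraph (Fin n)) (S : Finset (Fin n)), numEdges G = m ∧ G.IsNClique p S := by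
  classical
  obtain ⟨S, -, hS⟩ := Finset.exists_subset_card_eq (s := (Finset.univ : Finset (Fin n))) (n := p)
    (by simpa using hpn)
  have hc : ∀ U : Finset (Fin n), (completeOn U).edgeSet.toFinset.card = U.card.choose 2 := by
    intro U
    rw [← ncard_edgeSet_completeOn, Set.ncard_eq_toFinset_card']
  have hsub : (completeOn S).edgeSet.toFinset ⊆
      (completeOn (Finset.univ : Finset (Fin n))).edgeSet.toFinset := by
    rw [Set.toFinset_subset_toFinset]
    refine SimpleGraph.edgeSet_mono fun u v h => ?_
    exact ⟨h.1, Finset.mem_univ _, Finset.mem_univ _⟩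
  obtain ⟨E, hSE, hE, hcard⟩ := Finset.exists_subsuperset_card_eq hsub (n := m)
    (by rw [hc, hS]; exact hm) (by rw [hc]; simpa using hmn)
  have hedge : (SimpleGraph.fromEdgeSet (E : Set (Sym2 (Fin n)))).edgeSet = E := by
    rw [SimpleGraph.edgeSet_fromEdgeSet, sdiff_eq_left, Set.disjoint_left]
    intro e he hdiag
    have := Set.mem_toFinset.1 (hE he)
    exact SimpleGraph.not_isDiag_of_mem_edgeSet _ this hdiag
  refine ⟨SimpleGraph.fromEdgeSet (E : Set (Sym2 (Fin n))), S, ?_, fun u hu v hv huv => ?_, hS⟩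
  · rw [numEdges, hedge, Set.ncard_coe_finset, hcard]
  · rw [SimpleGraph.fromEdgeSet_adj]
    refine ⟨hSE ?_, huv⟩
    rw [Set.mem_toFinset]
    exact ⟨huv, hu, hv⟩

namespace Algorithm

variable {n B p : ℕ} (A : Algorithm n B)

lemma law_real_not_listsBy_le {G : SimpleGraph (Fin n)} {ε : ℝ}
    (h : 1 - ε ≤ A.law.real {ω | ∃ t : ℕ, A.ListsBy p G ω t}) :
    A.law.real {ω | ∃ t : ℕ, A.ListsBy p G ω t}ᶜ ≤ ε := by
  rw [probReal_compl_eq_one_sub (A.measurableSet_exists_listsBy p G)]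
  linarith

/-- Deleting the edge `xy` leaves the neighbours of `v`, and so its initial output, unchanged, but
`S` is no longer a clique. -/
lemma not_mem_output_zero {G : SimpleGraph (Fin n)} {ω : A.Coins} {x y v : Fin n}
    {S : Finset (Fin n)} (hx : x ∈ S) (hy : y ∈ S) (hxy : x ≠ y) (hvx : v ≠ x) (hvy : v ≠ y)
    (hlists : ∃ t, A.ListsBy p (G.deleteEdges {s(x, y)}) ω t) {L : Set (Finset (Fin n))}
    (hL : A.output (A.run G ω 0 v) = some L) : S ∉ L := by
  intro hS
  have hnb : (G.deleteEdges {s(x, y)}).neighborSet v = G.neighborSet v := by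
    ext w
    simp only [SimpleGraph.mem_neighborSet, SimpleGraph.deleteEdges_adj, Set.mem_singleton_iff,
      Sym2.eq_iff]
    tauto
  have hrun : A.run (G.deleteEdges {s(x, y)}) ω 0 v = A.run G ω 0 v := by
    rw [run, run, hnb]
  obtain ⟨t, ht⟩ := hlists
  have hmem : S ∈ (G.deleteEdges {s(x, y)}).cliqueSet p := by
    rw [← ht.2]
    refine ⟨v, L, ?_, hS⟩
    rw [A.run_of_isSome_of_le (s := 0) (by rw [hrun, hL]; rfl) (Nat.zero_le t), hrun, hL]
  have := (SimpleGraph.mem_cliqueSet_iff.1 hmem).isClique hx hy hxy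
  simp at this

/-- Among three vertices of `S`, two differ from the node that lists `S`. So halting at time `0`
implies failure on `G` or on one of the three graphs with an edge of the triangle deleted, giving
four events of probability at most `ε`. -/
lemma law_real_haltsBy_zero_le {G : SimpleGraph (Fin n)} {S : Finset (Fin n)} (hp : 3 ≤ p)
    (hS : G.IsNClique p S) {ε : ℝ}
    (h : ∀ G' ≤ G, 1 - ε ≤ A.law.real {ω | ∃ t : ℕ, A.ListsBy p G' ω t}) :
    A.law.real {ω | A.HaltsBy G ω 0} ≤ 4 * ε := by
  obtain ⟨x, y, z, hx, hy, hz, hxy, hxz, hyz⟩ := Finset.two_lt_card_iff.1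
    (show 2 < S.card by rw [hS.card_eq]; omega)
  let bad : SimpleGraph (Fin n) → Set A.Coins := fun G' => {ω | ∃ t : ℕ, A.ListsBy p G' ω t}ᶜ
  have hbad : ∀ G' ≤ G, A.law.real (bad G') ≤ ε := fun G' hG' =>
    A.law_real_not_listsBy_le (h G' hG')
  have hdel : ∀ e, G.deleteEdges e ≤ G := fun e => SimpleGraph.deleteEdges_le _
  have hsub : {ω | A.HaltsBy G ω 0} ⊆ (bad G ∪ bad (G.deleteEdges {s(x, y)})) ∪
      (bad (G.deleteEdges {s(x, z)}) ∪ bad (G.deleteEdges {s(y, z)})) := by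
    intro ω hω
    by_contra hcon
    simp only [bad, Set.mem_union, Set.mem_compl_iff, Set.mem_ofPred_eq, not_or, not_not] at hcon
    obtain ⟨⟨⟨t, h0⟩, h1⟩, h2, h3⟩ := hcon
    have h0 := h0.of_haltsBy hω
    have hmem : S ∈ G.cliqueSet p := hS
    rw [← h0.2] at hmem
    obtain ⟨v, L, hL, hSL⟩ := hmem
    by_cases hvx : v = x
    · subst hvx
      exact A.not_mem_output_zero hy hz hyz hxy hxz h3 hL hSL
    · by_cases hvy : v = y
      · subst hvy
        exact A.not_mem_output_zero hx hz hxz hvx hyz h2 hL hSL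
      · exact A.not_mem_output_zero hx hy hxy hvx hvy h1 hL hSL
  have hb0 := hbad G le_rfl
  have hb1 := hbad _ (hdel {s(x, y)})
  have hb2 := hbad _ (hdel {s(x, z)})
  have hb3 := hbad _ (hdel {s(y, z)})
  have := measureReal_union_le (μ := A.law) (bad G) (bad (G.deleteEdges {s(x, y)}))
  have := measureReal_union_le (μ := A.law) (bad (G.deleteEdges {s(x, z)}))
    (bad (G.deleteEdges {s(y, z)}))
  have := measureReal_union_le (μ := A.law) (bad G ∪ bad (G.deleteEdges {s(x, y)}))
    (bad (G.deleteEdges {s(x, z)}) ∪ bad (G.deleteEdges {s(y, z)}))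
  have := measureReal_mono (μ := A.law) hsub
  linarith

/-- Fixing the coins by averaging over a family of graphs. -/
lemma exists_coins {Φ : Type*} [Fintype Φ] (Gr : Φ → SimpleGraph (Fin n)) (t : ℕ) {δ : ℝ}
    (h : ∀ f, δ ≤ A.law.real {ω | A.ListsBy p (Gr f) ω t}) :
    ∃ ω, δ * Fintype.card Φ ≤ Nat.card {f // A.ListsBy p (Gr f) ω t} := by
  classical
  let F : Φ → A.Coins → ℝ := fun f => Set.indicator {ω | A.ListsBy p (Gr f) ω t} 1
  have hint : ∀ f, Integrable (F f) A.law := fun f =>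
    (integrable_const (1 : ℝ)).indicator (A.measurableSet_listsBy p (Gr f) t)
  obtain ⟨ω, hω⟩ := exists_integral_le (integrable_finsetSum Finset.univ fun f _ => hint f)
  refine ⟨ω, ?_⟩
  rw [integral_finsetSum _ fun f _ => hint f] at hω
  have h1 : δ * Fintype.card Φ ≤ ∑ f, ∫ ω, F f ω ∂A.law := by
    calc δ * Fintype.card Φ = ∑ _f : Φ, δ := by simp [mul_comm]
      _ ≤ _ := by
        refine Finset.sum_le_sum fun f _ => ?_
        rw [integral_indicator_one (A.measurableSet_listsBy p (Gr f) t)]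
        exact h f
  refine h1.trans (hω.trans_eq ?_)
  rw [Nat.card_eq_fintype_card, Fintype.card_subtype]
  simp [F, Set.indicator_apply, Finset.sum_boole]

end Algorithm

/-! ### The lower bound -/

lemma exists_blocks {α : Type*} {T : Set α} (hT : T.Finite) {M s : ℕ} (hM : T.ncard = M)
    (hs : s ≠ 0) : ∃ g : α → Fin (M / s + 1) × Fin s, Set.InjOn g T := by
  classical
  subst hM
  have : Finite T := hT
  let e : T ≃ Fin T.ncard := Finite.equivFinOfCardEq (Nat.card_coe_set_eq T)
  have : NeZero s := ⟨hs⟩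
  refine ⟨fun x => if h : x ∈ T then (⟨e ⟨x, h⟩ / s, Nat.lt_succ_of_le
    (Nat.div_le_div_right (e ⟨x, h⟩).2.le)⟩, ⟨e ⟨x, h⟩ % s, Nat.mod_lt _ (Nat.pos_of_ne_zero hs)⟩)
    else (0, 0), fun x hx y hy h => ?_⟩
  simp only [hx, hy, dif_pos, Prod.mk.injEq, Fin.mk.injEq] at h
  have : (e ⟨x, hx⟩ : ℕ) = e ⟨y, hy⟩ := by
    rw [← Nat.div_add_mod (e ⟨x, hx⟩ : ℕ) s, ← Nat.div_add_mod (e ⟨y, hy⟩ : ℕ) s, h.1, h.2]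
  simpa using e.injective (Fin.ext this)

/-- With few rounds, a deterministic algorithm fails on most of the graphs `holeGraph U g f`. -/
lemma card_listsBy_holeGraph_lt {n B p s t : ℕ} (A : Algorithm n B) (ω : A.Coins)
    {U : Finset (Fin n)} {κ : Type*} [Fintype κ] {g : Sym2 (Fin n) → κ × Fin s}
    (hg : Set.InjOn g (completeOn U).edgeSet) (hs : s ≠ 0) (hn : n ≠ 0) (hp : 2 ≤ p)
    (hpU : 2 * p ≤ U.card) (hκ : 2 * (Fintype.card κ * p.choose 2) ≤ U.card.choose 2)
    (ht : (n : ℝ) * (3 + t * (B + 1)) <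
      (U.card : ℝ) ^ 2 / (16 * (n : ℝ) ^ (2 / (p : ℝ))) / s) :
    (Nat.card {f : κ → Fin s // A.ListsBy p (holeGraph U g f) ω t} : ℝ) <
      1 / n * (s : ℝ) ^ Fintype.card κ := by
  classical
  have hn0 : (0 : ℝ) < n := by exact_mod_cast Nat.pos_of_ne_zero hn
  have hs0 : (0 : ℝ) < s := by exact_mod_cast Nat.pos_of_ne_zero hs
  have hp0 : (0 : ℝ) < p := by positivity
  set N := U.card with hN
  set r := (n : ℝ) ^ (2 / (p : ℝ)) with hr
  have hr0 : 0 < r := by positivity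
  have hrp : r ^ p = (n : ℝ) ^ 2 := by
    rw [hr, ← Real.rpow_natCast, ← Real.rpow_mul hn0.le, ← Real.rpow_natCast]
    congr 1
    field_simp
    norm_num
  set d := (N : ℝ) ^ 2 / (16 * r) with hd
  have hdesc : ((N : ℝ) / 2) ^ p ≤ (p.factorial : ℝ) * N.choose p := by
    have h1 : (N + 1 - p) ^ p ≤ p.factorial * N.choose p := by
      rw [← Nat.descFactorial_eq_factorial_mul_choose]
      exact Nat.pow_sub_le_descFactorial N p
    have h2 : (N : ℝ) / 2 ≤ ((N + 1 - p : ℕ) : ℝ) := by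
      rw [Nat.cast_sub (by omega)]
      have : (2 : ℝ) * p ≤ N := by exact_mod_cast hpU
      push_cast
      linarith
    calc ((N : ℝ) / 2) ^ p ≤ ((N + 1 - p : ℕ) : ℝ) ^ p := by gcongr
      _ ≤ _ := by exact_mod_cast h1
  have hmain := A.card_listsBy_le (p := p) (fun f : κ → Fin s => holeGraph U g f) ω t
    ((N.choose p : ℝ) / 2) ((s : ℝ) ^ Fintype.card κ * Real.exp (-(d / s)))
    (fun f => by
      have := choose_le_two_mul_ncard_cliqueSet hg f hp (by omega) hκ
      have : (N.choose p : ℝ) ≤ 2 * ((holeGraph U g f).cliqueSet p).ncard := by exact_mod_cast this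
      linarith)
    (fun L hL => by
      refine card_forall_isNClique_holeGraph_le hg hs hp L ?_
      -- Since `r ^ p = n²`, the left side of the goal is `N^(2p) / (8^p n²)`, while squaring this
      -- bound gives `N^(2p) / (4^p * 4 n²)`. The constant `16` in `d` makes `4 * 4^p ≤ 8^p`
      -- suffice, which holds for `p ≥ 2`.
      have h1 : ((N : ℝ) / 2) ^ p / (2 * n) ≤ (p.factorial : ℝ) * L.card := by
        rw [div_le_iff₀ (by positivity)]
        have h2 : (p.factorial : ℝ) * ((N.choose p : ℝ) / 2) ≤ p.factorial * (n * L.card) := by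
          gcongr
        linarith
      refine le_trans ?_ (pow_le_pow_left₀ (by positivity) h1 2)
      have e1 : (2 * d) ^ p = ((N : ℝ) ^ p) ^ 2 / (8 ^ p * (n : ℝ) ^ 2) := by
        rw [hd, ← hrp, ← mul_pow, ← pow_mul, mul_comm p 2, pow_mul, ← div_pow]
        congr 1
        field_simp
        ring
      have e2 : (((N : ℝ) / 2) ^ p / (2 * n)) ^ 2 = ((N : ℝ) ^ p) ^ 2 / (4 ^ p * 4 * (n : ℝ) ^ 2) := by
        have : (4 : ℝ) ^ p = (2 ^ p) ^ 2 := by rw [← pow_mul, mul_comm p 2, pow_mul]; norm_num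
        rw [this, div_pow, div_pow, div_pow]
        field_simp
        norm_num
      rw [e1, e2]
      gcongr
      have e3 : (8 : ℝ) ^ p = 4 ^ p * 2 ^ p := by rw [← mul_pow]; norm_num
      rw [e3]
      gcongr
      calc (4 : ℝ) = 2 ^ 2 := by norm_num
        _ ≤ 2 ^ p := pow_le_pow_right₀ (by norm_num) hp)
    (by positivity) hn
  refine lt_of_le_of_lt hmain ?_
  have h2 : (2 : ℝ) ≤ Real.exp 1 := by
    have := Real.add_one_le_exp (1 : ℝ)
    linarith
  have hpow : ∀ k : ℕ, (2 : ℝ) ^ k ≤ Real.exp k := by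
    intro k
    calc (2 : ℝ) ^ k ≤ Real.exp 1 ^ k := by gcongr
      _ = Real.exp k := by rw [← Real.exp_nat_mul]; simp
  have hB : (2 : ℝ) ^ B + 1 ≤ Real.exp (B + 1) := by
    have h3 := hpow (B + 1)
    have h4 : (1 : ℝ) ≤ 2 ^ B := one_le_pow₀ (by norm_num)
    rw [pow_succ] at h3
    push_cast at h3
    linarith
  have hnexp : (n : ℝ) ≤ Real.exp n := by
    have := Real.add_one_le_exp (n : ℝ)
    linarith
  -- The `3` in `ht` pays for the target `1 / n`, the choice of the node and its neighbourhood, each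
  -- at most `exp n`.
  have hcount : (n : ℝ) * (n * (2 ^ n * ((2 : ℝ) ^ B + 1) ^ (n * t))) ≤
      Real.exp (n * (3 + t * (B + 1))) := by
    calc (n : ℝ) * (n * (2 ^ n * ((2 : ℝ) ^ B + 1) ^ (n * t)))
        ≤ Real.exp n * (Real.exp n * (Real.exp n * Real.exp (B + 1) ^ (n * t))) := by
          gcongr
          exact hpow n
      _ = Real.exp (n * (3 + t * (B + 1))) := by
          rw [← Real.exp_nat_mul, ← Real.exp_add, ← Real.exp_add, ← Real.exp_add]
          congr 1
          push_cast
          ring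
  have hlt : (n : ℝ) * (n * (2 ^ n * ((2 : ℝ) ^ B + 1) ^ (n * t))) * Real.exp (-(d / s)) < 1 := by
    rw [Real.exp_neg, ← div_eq_mul_inv, div_lt_one (Real.exp_pos _)]
    exact hcount.trans_lt (Real.exp_lt_exp.2 ht)
  have hsκ : (0 : ℝ) < (s : ℝ) ^ Fintype.card κ := by positivity
  rw [one_div, inv_mul_eq_div, lt_div_iff₀ hn0]
  calc _ = ((n : ℝ) * (n * (2 ^ n * ((2 : ℝ) ^ B + 1) ^ (n * t))) * Real.exp (-(d / s))) *
        (s : ℝ) ^ Fintype.card κ := by ring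
    _ < 1 * (s : ℝ) ^ Fintype.card κ := by gcongr
    _ = _ := one_mul _

lemma two_mul_choose_two_add (N : ℕ) : 2 * N.choose 2 + N = N * N := by
  induction N with
  | zero => rfl
  | succ N ih =>
    rw [Nat.choose_succ_succ' N 1, Nat.choose_one_right]
    linarith

lemma exists_choose_two_le {n m : ℕ} (hmn : m ≤ n.choose 2) :
    ∃ N ≤ n, N.choose 2 ≤ m ∧ m ≤ N.choose 2 + N := by
  classical
  set N := Nat.findGreatest (fun N => N.choose 2 ≤ m) n with hN
  have h1 : N.choose 2 ≤ m :=
    Nat.findGreatest_spec (P := fun N => N.choose 2 ≤ m) (Nat.zero_le n) (by simp)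
  refine ⟨N, Nat.findGreatest_le n, h1, ?_⟩
  rcases Nat.lt_or_ge N n with h | h
  · have := Nat.findGreatest_is_greatest (P := fun N => N.choose 2 ≤ m) (Nat.lt_succ_self N) h
    have e : (N + 1).choose 2 = N + N.choose 2 := by
      rw [Nat.choose_succ_succ' N 1, Nat.choose_one_right]
    simp only [not_le, Nat.succ_eq_add_one, e] at this
    omega
  · have : N = n := le_antisymm (Nat.findGreatest_le n) h
    rw [this]
    omega

/-- The constant of the lower bound. -/
def lowerConst (b : ℕ) (L : ℝ) : ℝ := 1 / (1000 * L ^ 2 * (2 * b + 1))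

/-- If the claimed bound exceeds one round, then `m` is large compared with `p²` and the lower-order
terms can be absorbed. -/
lemma density_large {b : ℕ} {L ℓ X : ℝ} (hL : 1 ≤ L) (hℓ : 1 ≤ ℓ)
    (hτ : 1 < lowerConst b L * (1 + X) / ℓ ^ 3) : 999 * (L * ℓ) ^ 2 ≤ X := by
  have hL0 : 0 < L := by linarith
  have hℓ0 : 0 < ℓ := by linarith
  have hb : (1 : ℝ) ≤ 2 * b + 1 := by
    have : (0 : ℝ) ≤ b := by positivity
    linarith
  rw [lowerConst, lt_div_iff₀ (by positivity), one_mul, one_div, inv_mul_eq_div,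
    lt_div_iff₀ (by positivity)] at hτ
  have h1 : 1000 * (L * ℓ) ^ 2 ≤ ℓ ^ 3 * (1000 * L ^ 2 * (2 * b + 1)) := by
    calc 1000 * (L * ℓ) ^ 2 = ℓ ^ 2 * (1000 * L ^ 2 * 1) := by ring
      _ ≤ ℓ ^ 3 * (1000 * L ^ 2 * (2 * b + 1)) := by
        gcongr
        norm_num
  have h2 : (1 : ℝ) ≤ (L * ℓ) ^ 2 := one_le_pow₀ (one_le_mul_of_one_le_of_one_le hL hℓ)
  linarith

/-- Of the three logarithmic factors, one pays for the bandwidth and two for the block size `2p² ≤ 2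
(L ℓ)²`. -/
lemma rounds_lt {b B p n m N t : ℕ} {L ℓ : ℝ} (hL : 1 ≤ L) (hℓ : 1 ≤ ℓ) (hp : 0 < p) (hn : 0 < n)
    (hpℓ : (p : ℝ) ≤ L * ℓ) (hB : (B : ℝ) ≤ 2 * b * ℓ) (hm : (m : ℝ) ≤ (N : ℝ) ^ 2)
    (hτ : 1 < lowerConst b L * cost p n m / ℓ ^ 3)
    (ht : (t : ℝ) ≤ lowerConst b L * cost p n m / ℓ ^ 3) :
    (n : ℝ) * (3 + t * (B + 1)) <
      (N : ℝ) ^ 2 / (16 * (n : ℝ) ^ (2 / (p : ℝ))) / (2 * p ^ 2 : ℕ) := by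
  have hL0 : 0 < L := by linarith
  have hℓ0 : 0 < ℓ := by linarith
  have hn0 : (0 : ℝ) < n := by exact_mod_cast hn
  have hp0 : (0 : ℝ) < p := by exact_mod_cast hp
  have hb : (0 : ℝ) ≤ b := by positivity
  set r := (n : ℝ) ^ (2 / (p : ℝ)) with hr
  have hr0 : 0 < r := by positivity
  have hcost : cost p n m = 1 + m / (n * r) := by
    rw [cost, Real.rpow_add hn0, Real.rpow_one]
  rw [hcost] at hτ ht
  set X := (m : ℝ) / (n * r) with hX
  have hlarge := density_large hL hℓ hτ
  have hX0 : 0 ≤ X := by positivity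
  have hy : 0 < (L * ℓ) ^ 2 := by positivity
  have h1 : n * (X / (32 * (L * ℓ) ^ 2)) ≤ (N : ℝ) ^ 2 / (16 * r) / (2 * p ^ 2 : ℕ) := by
    push_cast
    calc n * (X / (32 * (L * ℓ) ^ 2)) ≤ n * (X / (32 * (p : ℝ) ^ 2)) := by gcongr
      _ = m / (16 * r) / (2 * (p : ℝ) ^ 2) := by
        rw [hX]
        field_simp
        ring
      _ ≤ _ := by gcongr
  refine lt_of_lt_of_le ?_ h1
  gcongr
  have h2 : (t : ℝ) * (B + 1) ≤ (1 + X) / (1000 * (L * ℓ) ^ 2) := by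
    calc (t : ℝ) * (B + 1) ≤ (lowerConst b L * (1 + X) / ℓ ^ 3) * ((2 * b + 1) * ℓ) := by
          gcongr
          linarith
      _ = (1 + X) / (1000 * (L * ℓ) ^ 2) := by
          rw [lowerConst]
          field_simp
  have h3 : (1 + X) / (1000 * (L * ℓ) ^ 2) + 3 < X / (32 * (L * ℓ) ^ 2) := by
    have e1 : (1 + X) / (1000 * (L * ℓ) ^ 2) + 3 =
        (1 + X + 3000 * (L * ℓ) ^ 2) / (1000 * (L * ℓ) ^ 2) := by
      field_simp
      ring
    rw [e1, div_lt_div_iff₀ (by positivity) (by positivity)]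
    have h4 : (1 : ℝ) ≤ (L * ℓ) ^ 2 := one_le_pow₀ (one_le_mul_of_one_le_of_one_le hL hℓ)
    nlinarith
  linarith

theorem exists_slow_graph {b p n m : ℕ} {L : ℝ} (hL : 1 ≤ L) (hp : 3 ≤ p)
    (hpL : (p : ℝ) ≤ L * Real.logb 2 n) (hpm : p.choose 2 ≤ m) (hmn : m ≤ n.choose 2)
    (A : Algorithm n (b * Nat.clog 2 n)) (ε : ℝ)
    (hA : ∀ G : SimpleGraph (Fin n), numEdges G ≤ m →
      1 - ε ≤ A.law.real {ω | ∃ t : ℕ, A.ListsBy p G ω t}) :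
    ∃ G : SimpleGraph (Fin n), numEdges G ≤ m ∧ m ≤ 4 * numEdges G ∧
      1 - 4 * ε - 1 / (n : ℝ) ≤ A.law.real {ω | ∀ t : ℕ, A.HaltsBy G ω t →
        lowerConst b L * cost p n m / Real.logb 2 n ^ 3 ≤ (t : ℝ)} := by
  classical
  have hpn : p ≤ n := by
    by_contra! h
    have h1 : (n + 1).choose 2 = n + n.choose 2 := by
      rw [Nat.choose_succ_succ' n 1, Nat.choose_one_right]
    have h2 := Nat.choose_le_choose 2 (show n + 1 ≤ p from h)
    have h3 : n = 0 := by omega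
    subst h3
    have h4 := Nat.choose_le_choose 2 hp
    simp [Nat.choose] at hmn h4
    omega
  have hn0 : (0 : ℝ) < n := by exact_mod_cast (show 0 < n by omega)
  set ℓ := Real.logb 2 n with hℓ
  have hℓ1 : 1 ≤ ℓ := by
    rw [hℓ, Real.le_logb_iff_rpow_le (by norm_num) hn0, Real.rpow_one]
    exact_mod_cast (show 2 ≤ n by omega)
  set τ := lowerConst b L * cost p n m / ℓ ^ 3 with hτ
  have hcompl : ∀ (G : SimpleGraph (Fin n)) (t₀ : ℕ), τ ≤ t₀ + 1 →
      1 - A.law.real {ω | A.HaltsBy G ω t₀} ≤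
        A.law.real {ω | ∀ t : ℕ, A.HaltsBy G ω t → τ ≤ (t : ℝ)} := by
    intro G t₀ ht₀
    rw [← probReal_compl_eq_one_sub (A.measurableSet_haltsBy G t₀)]
    refine measureReal_mono fun ω hω t ht => ?_
    have : t₀ + 1 ≤ t := by
      by_contra! hlt
      exact hω (ht.mono (Nat.le_of_lt_succ hlt))
    exact ht₀.trans (by exact_mod_cast this)
  rcases le_or_gt τ 1 with hτ1 | hτ1
  · obtain ⟨G, S, hG, hS⟩ := exists_graph_with_clique hpn hpm hmn
    refine ⟨G, hG.le, by omega, ?_⟩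
    have h1 := A.law_real_haltsBy_zero_le hp hS (ε := ε) fun G' hG' => hA G' (by
      rw [← hG]
      exact Set.ncard_le_ncard (SimpleGraph.edgeSet_mono hG') (Set.toFinite _))
    have h2 := hcompl G 0 (by simpa using hτ1)
    have h3 : (0 : ℝ) < 1 / n := by positivity
    linarith
  · obtain ⟨N, hNn, hNm, hmN⟩ := exists_choose_two_le hmn
    have hchoose := two_mul_choose_two_add N
    have hmN2 : m ≤ N * N := by
      have : N ≤ N * N := Nat.le_mul_self N
      omega
    have hXlarge := density_large hL hℓ1 (by simpa only [hτ, cost] using hτ1)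
    have hmlarge : 999 * p ^ 2 ≤ m := by
      have h1 : (m : ℝ) / (n : ℝ) ^ (1 + 2 / (p : ℝ)) ≤ m := by
        refine div_le_self (by positivity) (Real.one_le_rpow ?_ (by positivity))
        exact_mod_cast (show 1 ≤ n by omega)
      have h2 : (p : ℝ) ^ 2 ≤ (L * ℓ) ^ 2 := by gcongr
      have : (999 : ℝ) * p ^ 2 ≤ m := by linarith
      exact_mod_cast this
    -- Otherwise `m ≤ N² ≤ 961 p²`, against `hmlarge`.
    have hNp : 31 * p ≤ N := by
      by_contra! h
      have : N * N ≤ (31 * p) * (31 * p) := Nat.mul_le_mul h.le h.le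
      nlinarith
    obtain ⟨U, -, hU⟩ := Finset.exists_subset_card_eq (s := (Finset.univ : Finset (Fin n))) (n := N)
      (by simpa using hNn)
    -- Blocks of this size keep the holes few enough for half of the cliques to survive: `(M / s +
    -- 1) * p² ≤ M / 2 + p² ≤ M`.
    set s := 2 * p ^ 2 with hs
    have hs0 : s ≠ 0 := by positivity
    set M := N.choose 2 with hM
    obtain ⟨g, hg⟩ := exists_blocks (completeOn U).edgeSet.toFinite (M := M)
      (by rw [ncard_edgeSet_completeOn, hU]) hs0
    have hN2 : 93 * N ≤ N * N := Nat.mul_le_mul_right N (by omega)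
    have hMN : 46 * N ≤ M := by omega
    have hp2 : 2 * p ^ 2 ≤ M := by
      have h1 : (31 * p) * (31 * p) ≤ N * N := Nat.mul_le_mul hNp hNp
      nlinarith
    have hκ : 2 * (Fintype.card (Fin (M / s + 1)) * p.choose 2) ≤ U.card.choose 2 := by
      rw [Fintype.card_fin, hU, ← hM]
      have h1 := two_mul_choose_two_add p
      have h2 : M / s * (2 * p ^ 2) ≤ M := Nat.div_mul_le_self M s
      have h3 : (M / s + 1) * (2 * p.choose 2) ≤ (M / s + 1) * p ^ 2 :=
        Nat.mul_le_mul_left _ (by nlinarith)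
      nlinarith
    by_contra! hcon
    set t₀ := ⌊τ⌋₊ with ht₀
    -- If no graph is slow, each `holeGraph` halts by time `t₀` with probability above `4ε + 1/n`.
    -- Failure to list costs at most `ε`, and `ε ≥ 0` because it bounds a probability, so more than
    -- `1/n` remains.
    have hlists : ∀ f : Fin (M / s + 1) → Fin s,
        1 / (n : ℝ) ≤ A.law.real {ω | A.ListsBy p (holeGraph U g f) ω t₀} := by
      intro f
      have he1 : numEdges (holeGraph U g f) ≤ M := by
        have := ncard_edgeSet_holeGraph_le (U := U) g f
        rwa [hU] at this
      have he2 : M ≤ numEdges (holeGraph U g f) + (M / s + 1) := by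
        have := le_ncard_edgeSet_holeGraph_add hg f
        rwa [hU, Fintype.card_fin] at this
      have hs18 : M / s ≤ M / 18 := Nat.div_le_div_left (by nlinarith) (by norm_num)
      have h1 := hcon (holeGraph U g f) (he1.trans hNm) (by omega)
      have h2 := hcompl (holeGraph U g f) t₀ (Nat.lt_floor_add_one τ).le
      have h3 := A.law_real_not_listsBy_le (hA (holeGraph U g f) (he1.trans hNm))
      have h4 : (0 : ℝ) ≤ A.law.real {ω | ∃ t : ℕ, A.ListsBy p (holeGraph U g f) ω t}ᶜ :=
        measureReal_nonneg
      have h5 : {ω | A.HaltsBy (holeGraph U g f) ω t₀} ⊆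
          {ω | A.ListsBy p (holeGraph U g f) ω t₀} ∪
            {ω | ∃ t : ℕ, A.ListsBy p (holeGraph U g f) ω t}ᶜ := by
        intro ω hω
        by_cases h : ∃ t : ℕ, A.ListsBy p (holeGraph U g f) ω t
        · obtain ⟨t, ht⟩ := h
          exact Or.inl (ht.of_haltsBy hω)
        · exact Or.inr h
      have h6 := (measureReal_mono (μ := A.law) h5).trans (measureReal_union_le _ _)
      linarith
    obtain ⟨ω, hω⟩ := A.exists_coins (fun f => holeGraph U g f) t₀ hlists
    have hclog : (Nat.clog 2 n : ℝ) ≤ 2 * ℓ := by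
      have h1 : ⌈ℓ⌉₊ = Nat.clog 2 n := Real.natCeil_logb_natCast 2 n
      have h2 := (Nat.ceil_lt_add_one (show 0 ≤ ℓ by linarith)).le
      rw [h1] at h2
      linarith
    have hB : ((b * Nat.clog 2 n : ℕ) : ℝ) ≤ 2 * b * ℓ := by
      push_cast
      calc (b : ℝ) * Nat.clog 2 n ≤ b * (2 * ℓ) := by gcongr
        _ = 2 * b * ℓ := by ring
    have hlt := card_listsBy_holeGraph_lt A ω (t := t₀) hg hs0 (by omega) (by omega)
      (by omega) hκ (by
        rw [hU]
        exact rounds_lt hL hℓ1 (by omega) (by omega) hpL hB (by exact_mod_cast (pow_two N ▸ hmN2))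
          hτ1 (Nat.floor_le (by linarith)))
    simp only [Fintype.card_fun, Fintype.card_fin] at hω hlt
    push_cast at hω
    linarith

end CongestedClique

end

theorem theorem3 :
    -- upper bound
    (∃ b k : ℕ, ∀ a : ℕ, ∃ C : ℝ, 0 < C ∧
      ∀ p n : ℕ, 3 ≤ p → 2 ≤ n →
        ∃ A : CongestedClique.Algorithm n (b * Nat.clog 2 n),
          ∀ G : SimpleGraph (Fin n),
            1 - 1 / (n : ℝ) ^ a ≤
              A.law.real {ω | ∃ t : ℕ,
                (t : ℝ) ≤ C * Real.logb 2 n ^ k *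
                    CongestedClique.cost p n (CongestedClique.numEdges G) ∧
                  A.ListsBy p G ω t}) ∧
    -- lower bound
    (∃ k : ℕ, ∀ (b : ℕ) (lam : ℝ), ∃ c : ℝ, 0 < c ∧
      ∀ p n m : ℕ, 3 ≤ p → (p : ℝ) ≤ lam * Real.logb 2 n →
        p.choose 2 ≤ m → m ≤ n.choose 2 →
        ∀ (A : CongestedClique.Algorithm n (b * Nat.clog 2 n)) (ε : ℝ),
          (∀ G : SimpleGraph (Fin n), CongestedClique.numEdges G ≤ m →
            1 - ε ≤ A.law.real {ω | ∃ t : ℕ, A.ListsBy p G ω t}) →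
          ∃ G : SimpleGraph (Fin n),
            CongestedClique.numEdges G ≤ m ∧ m ≤ 4 * CongestedClique.numEdges G ∧
            1 - 4 * ε - 1 / (n : ℝ) ≤
              A.law.real {ω | ∀ t : ℕ, A.HaltsBy G ω t →
                c * CongestedClique.cost p n m / Real.logb 2 n ^ k ≤ (t : ℝ)}) := by
  refine ⟨⟨6, 3, fun a => ⟨100 + 7 * a, by positivity, fun p n hp hn =>
    CongestedClique.exists_listing_algorithm a hp hn⟩⟩, 3, fun b lam =>
    ⟨CongestedClique.lowerConst b (max lam 1), ?_, fun p n m hp hpl hpm hmn A ε hA =>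
      CongestedClique.exists_slow_graph (le_max_right _ _) hp (hpl.trans ?_) hpm hmn A ε hA⟩⟩
  · have : 0 < max lam 1 := lt_max_of_lt_right one_pos
    rw [CongestedClique.lowerConst]
    positivity
  · refine mul_le_mul_of_nonneg_right (le_max_left _ _) ?_
    refine div_nonneg (Real.log_natCast_nonneg n) (Real.log_nonneg (by norm_num))
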